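/- Let $X$ be a closed Kähler manifold, i.e. a compact (Hausdorff) complex manifold without boundary, with complex structure $J$ and a smooth closed real $2$-form $\omega$ such that $\langle\cdot,\cdot\rangle:=\omega(\cdot,J\cdot)$ is a Riemannian metric. Let $G\subset U(n)$ be a compact Lie group (closed subgroup) with Lie algebra $\mathfrak g=\{\xi\in\mathbb C^{n\times n} : \exp(t\xi)\in G\ \text{for all } t\in\mathbb R\}$, equipped with an inner product $\langle\cdot,\cdot\rangle$ that is invariant under $\xi\mapsto u\xi u^{-1}$ for $u\in G$, and put $|\xi|:=\sqrt{\langle\xi,\xi\rangle}$. Suppose that $G$ acts smoothly on $X$ preserving $J$ and $\omega$, write $v_\xi(x):=\frac{d}{dt}\big|_{t=0}\exp(t\xi)x$, and let $\mu:X\to\mathfrak g$ be an equivariant moment map: for every $\xi\in\mathfrak g$ the function $H_\xi:=\langle\mu,\xi\rangle$ is smooth with $dH_\xi=\omega(v_\xi,\cdot)$, and $\mu(ux)=u\mu(x)u^{-1}$ for all $u\in G$, $x\in X$. Let $$G^c=\{\exp(i\eta)u : u\in G,\ \eta\in\mathfrak g\}\subset GL(n,\mathbb C)$$ be the complexification of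 $G$, acting on $X$ by the holomorphic group action that extends the action of $G$. Then for every $x\in X$ and every $\xi\in\mathfrak g\setminus\{0\}$ the limit $$w_\mu(x,\xi):=\lim_{t\to\infty}\langle\mu(\exp(it\xi)x),\xi\rangle$$ exists, and for every $g\in G^c$ $$\frac{-w_\mu(x,\xi)}{|\xi|}\le|\mu(gx)|.$$ -/

import Mathlib

open scoped Manifold ContDiff Topology
open Filter

namespace MomentWeight

/-! ### The compact group `G ⊆ U(n)` and its Lie algebra -/

/-- Complex `n × n` matrices. -/
abbrev Mat (n : ℕ) : Type := Matrix (Fin n) (Fin n) ℂ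

section Trotter

variable {A : Type*} [CStarAlgebra A]

theorem norm_le_one_of_unitary {a : A} (ha : a ∈ unitary A) : ‖a‖ ≤ 1 := by
  rcases subsingleton_or_nontrivial A with h | h
  · rw [Subsingleton.elim a 0]; simp
  · exact (CStarRing.norm_of_mem_unitary ha).le

theorem norm_pow_sub_pow_le_of_norm_le_one {a b : A} (ha : a ∈ unitary A) (hb : b ∈ unitary A)
    (m : ℕ) : ‖a ^ m - b ^ m‖ ≤ m * ‖a - b‖ := by
  induction m with
  | zero => simp
  | succ k ih =>
    have h1 : a ^ (k + 1) - b ^ (k + 1) = a ^ k * (a - b) + (a ^ k - b ^ k) * b := by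
      rw [pow_succ, pow_succ]; noncomm_ring
    have h2 : ‖a ^ k * (a - b)‖ ≤ 1 * ‖a - b‖ :=
      (norm_mul_le _ _).trans (mul_le_mul_of_nonneg_right
        (norm_le_one_of_unitary (pow_mem ha k)) (norm_nonneg _))
    have h3 : ‖(a ^ k - b ^ k) * b‖ ≤ ‖a ^ k - b ^ k‖ * 1 :=
      (norm_mul_le _ _).trans (mul_le_mul_of_nonneg_left
        (norm_le_one_of_unitary hb) (norm_nonneg _))
    rw [h1]
    push_cast
    calc _ ≤ _ := norm_add_le _ _
      _ ≤ _ := by linarith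

theorem hasDerivAt_exp_line (x : A) :
    HasDerivAt (fun t : ℝ => NormedSpace.exp ((t : ℂ) • x)) x 0 := by
  have h := hasDerivAt_exp_smul_const (𝕂 := ℝ) x (0 : ℝ)
  simpa using h

theorem star_eq_neg_of_exp_mem_unitary {x : A}
    (hx : ∀ t : ℝ, NormedSpace.exp ((t : ℂ) • x) ∈ unitary A) : star x = -x := by
  have h1 := (hasDerivAt_exp_line x).star
  have h2 := h1.mul (hasDerivAt_exp_line x)
  have h3 : (fun t : ℝ => star (NormedSpace.exp ((t : ℂ) • x)) *
      NormedSpace.exp ((t : ℂ) • x)) = fun _ => 1 := by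
    funext t; exact (Unitary.mem_iff.1 (hx t)).1
  have h4 := h2.unique ((hasDerivAt_const (0 : ℝ) (1 : A)).congr_of_eventuallyEq
    (Eventually.of_forall fun t => congrFun h3 t))
  have h5 : star x + x = 0 := by simpa using h4
  exact eq_neg_of_add_eq_zero_left h5

theorem exp_mem_unitary_of_star {x : A} (hx : star x = -x) (t : ℝ) :
    NormedSpace.exp ((t : ℂ) • x) ∈ unitary A := by
  let +nondep : NormedAlgebra ℚ A := .restrictScalars ℚ ℂ A
  apply NormedSpace.exp_mem_unitary_of_mem_skewAdjoint
  rw [skewAdjoint.mem_iff]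
  simp [hx]

/-- The Lie product formula for skew-adjoint elements. -/
theorem tendsto_lie_product {x y : A} (hx : star x = -x) (hy : star y = -y) (t : ℝ) :
    Tendsto (fun m : ℕ => (NormedSpace.exp (((t / m : ℝ) : ℂ) • x) *
      NormedSpace.exp (((t / m : ℝ) : ℂ) • y)) ^ m) atTop
      (𝓝 (NormedSpace.exp ((t : ℂ) • (x + y)))) := by
  have hxy : star (x + y) = -(x + y) := by rw [star_add, hx, hy]; abel
  have hd : HasDerivAt (fun s : ℝ => NormedSpace.exp (((s * t : ℝ) : ℂ) • x) *
      NormedSpace.exp (((s * t : ℝ) : ℂ) • y) -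
      NormedSpace.exp (((s * t : ℝ) : ℂ) • (x + y))) 0 0 := by
    have hl : ∀ z : A, HasDerivAt (fun s : ℝ => NormedSpace.exp (((s * t : ℝ) : ℂ) • z))
        ((t : ℂ) • z) 0 := by
      intro z
      have h := hasDerivAt_exp_line ((t : ℂ) • z)
      refine h.congr_of_eventuallyEq (Eventually.of_forall fun s => ?_)
      simp only [smul_smul, Complex.ofReal_mul]
    have h := ((hl x).mul (hl y)).sub (hl (x + y))
    refine h.congr_deriv ?_
    simp
  have hs := hd.tendsto_slope_zero_right
  have hm : Tendsto (fun m : ℕ => ((m : ℝ))⁻¹) atTop (𝓝[>] 0) :=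
    tendsto_inv_atTop_nhdsGT_zero.comp tendsto_natCast_atTop_atTop
  have hlim := (hs.comp hm).norm
  rw [tendsto_iff_norm_sub_tendsto_zero]
  rw [norm_zero] at hlim
  refine squeeze_zero' (Eventually.of_forall fun _ => norm_nonneg _) ?_ hlim
  filter_upwards [eventually_gt_atTop 0] with m hm0
  have hm0' : (m : ℝ) ≠ 0 := by positivity
  have hpow : NormedSpace.exp ((t : ℂ) • (x + y)) =
      NormedSpace.exp (((t / m : ℝ) : ℂ) • (x + y)) ^ m := by
    let +nondep : NormedAlgebra ℚ A := .restrictScalars ℚ ℂ A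
    have hm1 : (m : ℂ) ≠ 0 := by exact_mod_cast hm0'
    rw [← NormedSpace.exp_nsmul, ← Nat.cast_smul_eq_nsmul ℂ, smul_smul]
    congr 2
    push_cast
    field_simp
  rw [hpow]
  refine (norm_pow_sub_pow_le_of_norm_le_one
    (mul_mem (exp_mem_unitary_of_star hx _) (exp_mem_unitary_of_star hy _))
    (exp_mem_unitary_of_star hxy _) m).trans (le_of_eq ?_)
  simp [norm_smul, div_eq_inv_mul]

end Trotter

section Group

variable {n : ℕ}

theorem coe_smul_mat (t : ℝ) (ξ : Mat n) : (t : ℂ) • ξ = t • ξ := by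
  ext i j; simp

theorem exists_mem_of_val_eq {G : ClosedSubgroup (Matrix.unitaryGroup (Fin n) ℂ)}
    {u : Matrix.unitaryGroup (Fin n) ℂ} (hu : u ∈ G) {M : Mat n} (h : (u : Mat n) = M) :
    ∃ hM : M ∈ Matrix.unitaryGroup (Fin n) ℂ, (⟨M, hM⟩ : Matrix.unitaryGroup (Fin n) ℂ) ∈ G := by
  subst h
  exact ⟨u.2, hu⟩

/-- The Lie algebra `𝔤 = {ξ | exp (t ξ) ∈ G for all real t}` of a closed subgroup `G ⊆ U(n)`. -/
def lieAlg (G : ClosedSubgroup (Matrix.unitaryGroup (Fin n) ℂ)) : Submodule ℝ (Mat n) where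
  carrier := {ξ | ∀ t : ℝ, ∃ h : NormedSpace.exp (t • ξ) ∈ Matrix.unitaryGroup (Fin n) ℂ,
    (⟨NormedSpace.exp (t • ξ), h⟩ : Matrix.unitaryGroup (Fin n) ℂ) ∈ G}
  zero_mem' := by
    intro t
    exact exists_mem_of_val_eq (one_mem G)
      (by rw [smul_zero, NormedSpace.exp_zero, OneMemClass.coe_one])
  smul_mem' := by
    intro c ξ hξ t
    simpa only [smul_smul] using hξ (t * c)
  add_mem' := by
    intro ξ η hξ hη t
    open scoped Matrix.Norms.L2Operator in
    have hs : ∀ z : Mat n, (∀ t : ℝ, ∃ h : NormedSpace.exp (t • z) ∈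
        Matrix.unitaryGroup (Fin n) ℂ,
        (⟨NormedSpace.exp (t • z), h⟩ : Matrix.unitaryGroup (Fin n) ℂ) ∈ G) → star z = -z :=
      fun z hz => star_eq_neg_of_exp_mem_unitary fun t => by
        rw [coe_smul_mat]; exact (hz t).1
    open scoped Matrix.Norms.L2Operator in
    have hlim := tendsto_lie_product (hs ξ hξ) (hs η hη) t
    simp only [coe_smul_mat] at hlim
    have hclosed : IsClosed (Subtype.val '' (G : Set (Matrix.unitaryGroup (Fin n) ℂ))) := by
      refine (Topology.IsClosedEmbedding.isClosedMap ?_) _ G.isClosed'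
      exact (isClosed_unitary (R := Mat n)).isClosedEmbedding_subtypeVal
    have hmem := hclosed.mem_of_tendsto hlim (Eventually.of_forall fun m => by
      obtain ⟨h1, h1'⟩ := hξ (t / m)
      obtain ⟨h2, h2'⟩ := hη (t / m)
      exact ⟨_, pow_mem (mul_mem h1' h2') m, rfl⟩)
    obtain ⟨u, hu, hu'⟩ := hmem
    exact exists_mem_of_val_eq hu hu'

/-- The exponential map `𝔤 → G`. -/
noncomputable def expG {G : ClosedSubgroup (Matrix.unitaryGroup (Fin n) ℂ)} (ξ : lieAlg G) : G :=
  ⟨⟨NormedSpace.exp (ξ : Mat n), by simpa using (ξ.2 1).1⟩, by simpa using (ξ.2 1).2⟩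

theorem exp_conj_unitary (u : Matrix.unitaryGroup (Fin n) ℂ) (A : Mat n) :
    NormedSpace.exp ((u : Mat n) * A * star (u : Mat n)) =
      (u : Mat n) * NormedSpace.exp A * star (u : Mat n) := by
  have hu : (u : Mat n)⁻¹ = star (u : Mat n) :=
    Matrix.inv_eq_left_inv (Unitary.star_mul_self_of_mem u.2)
  have h := Matrix.exp_conj (u : Mat n) A
    (IsUnit.of_mul_eq_one _ (Unitary.mul_star_self_of_mem u.2))
  rwa [hu] at h

/-- The adjoint action `ξ ↦ u ξ u⁻¹` of `G` on `𝔤` (here `u⁻¹ = u*`). -/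
def Ad {G : ClosedSubgroup (Matrix.unitaryGroup (Fin n) ℂ)} (u : G) (ξ : lieAlg G) : lieAlg G :=
  ⟨(u : Mat n) * ξ * star (u : Mat n), by
    intro t
    obtain ⟨h, h'⟩ := ξ.2 t
    have key : NormedSpace.exp (t • ((u : Mat n) * ξ * star (u : Mat n))) =
        (u : Mat n) * NormedSpace.exp (t • (ξ : Mat n)) * star (u : Mat n) := by
      rw [← exp_conj_unitary, mul_smul_comm, smul_mul_assoc]
    exact exists_mem_of_val_eq (mul_mem (mul_mem u.2 h') (inv_mem u.2)) key.symm⟩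

/-- The matrix exponential with values in `GL(n, ℂ)`. -/
noncomputable def expGL (A : Mat n) : GL (Fin n) ℂ := (Matrix.isUnit_exp A).unit

/-- The complexification `Gᶜ ⊆ GL(n, ℂ)`: the subgroup generated by the elements `exp (i η) u`
with `η ∈ 𝔤` and `u ∈ G`. (These elements in fact already form a group, so that the closure adds
nothing.) -/
def complexification (G : ClosedSubgroup (Matrix.unitaryGroup (Fin n) ℂ)) :
    Subgroup (GL (Fin n) ℂ) :=
  Subgroup.closure {g | ∃ (η : lieAlg G) (u : G),
    g = expGL (Complex.I • (η : Mat n)) *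
      Unitary.toUnits (u : Matrix.unitaryGroup (Fin n) ℂ)}

/-- The inclusion `G → Gᶜ`. -/
noncomputable def inclG {G : ClosedSubgroup (Matrix.unitaryGroup (Fin n) ℂ)} (u : G) :
    complexification G :=
  ⟨Unitary.toUnits (u : Matrix.unitaryGroup (Fin n) ℂ), Subgroup.subset_closure
    ⟨0, u, by ext1; simp [expGL]⟩⟩

/-- The element `exp (i ξ) ∈ Gᶜ` for `ξ ∈ 𝔤`. -/
noncomputable def expI {G : ClosedSubgroup (Matrix.unitaryGroup (Fin n) ℂ)} (ξ : lieAlg G) :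
    complexification G :=
  ⟨expGL (Complex.I • (ξ : Mat n)), Subgroup.subset_closure ⟨ξ, 1, by ext1; simp⟩⟩

/-- An invariant inner product on `𝔤`. -/
structure IsInvariantInner {G : ClosedSubgroup (Matrix.unitaryGroup (Fin n) ℂ)}
    (B : LinearMap.BilinForm ℝ (lieAlg G)) : Prop where
  symm : ∀ ξ η, B ξ η = B η ξ
  pos : ∀ ξ, ξ ≠ 0 → 0 < B ξ ξ
  invariant : ∀ (u : G) (ξ η), B (Ad u ξ) (Ad u η) = B ξ η

/-- The norm `|ξ|` of the inner product `B`. -/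
noncomputable def innerNorm {G : ClosedSubgroup (Matrix.unitaryGroup (Fin n) ℂ)}
    (B : LinearMap.BilinForm ℝ (lieAlg G)) (ξ : lieAlg G) : ℝ :=
  Real.sqrt (B ξ ξ)

end Group

/-! ### Kähler forms on complex manifolds

A complex manifold is a manifold `X` modelled on a complex vector space `E` with holomorphic
coordinate changes. Its real tangent space at `x` is `TangentSpace 𝓘(ℝ, E) x`, a copy of `E`
identified through the preferred chart at `x`, and `J` is multiplication by `i` there. -/

section Manifold

variable {E : Type*} [NormedAddCommGroup E] [NormedSpace ℂ E]
  {X : Type*} [TopologicalSpace X] [ChartedSpace E X]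

/-- The complex structure on the real tangent spaces of `X`. -/
noncomputable def J (x : X) : TangentSpace 𝓘(ℝ, E) x →L[ℝ] TangentSpace 𝓘(ℝ, E) x :=
  (Complex.I • ContinuousLinearMap.id ℝ E : E →L[ℝ] E)

/-- A real `2`-form on `X` (not necessarily continuous). -/
abbrev TwoForm (E : Type*) [NormedAddCommGroup E] [NormedSpace ℂ E]
    (X : Type*) [TopologicalSpace X] [ChartedSpace E X] : Type _ :=
  ∀ x : X, TangentSpace 𝓘(ℝ, E) x [⋀^Fin 2]→L[ℝ] ℝ

/-- The coordinate expression of a `2`-form in the preferred chart at `x₀`, that is, its pullback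
under the inverse of that chart. -/
noncomputable def TwoForm.inChart (Ω : TwoForm E X) (x₀ : X) (y : E) : E [⋀^Fin 2]→L[ℝ] ℝ :=
  (Ω ((extChartAt 𝓘(ℝ, E) x₀).symm y)).compContinuousLinearMap
    (mfderiv 𝓘(ℝ, E) 𝓘(ℝ, E) (extChartAt 𝓘(ℝ, E) x₀).symm y)

/-- `Ω` is a Kähler form: a smooth closed real `2`-form such that `⟨v, w⟩ = Ω(v, J w)` is symmetric
and positive definite, i.e. a Riemannian metric. -/
structure IsKaehlerForm (Ω : TwoForm E X) : Prop where
  smooth : ∀ x₀ : X, ContDiffOn ℝ ∞ (Ω.inChart x₀) (extChartAt 𝓘(ℝ, E) x₀).target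
  closed : ∀ x₀ : X, ∀ y ∈ (extChartAt 𝓘(ℝ, E) x₀).target, extDeriv (Ω.inChart x₀) y = 0
  symm : ∀ (x : X) (v w : TangentSpace 𝓘(ℝ, E) x), Ω x ![v, J x w] = Ω x ![w, J x v]
  pos : ∀ (x : X) (v : TangentSpace 𝓘(ℝ, E) x), v ≠ 0 → 0 < Ω x ![v, J x v]

end Manifold

/-! ### Group actions and moment maps -/

section Action

variable {n : ℕ} {E : Type*} [NormedAddCommGroup E] [NormedSpace ℂ E]
  {X : Type*} [TopologicalSpace X] [ChartedSpace E X]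

/-- Let `S` be (via `ι`) a Lie subgroup of `GL(n, ℂ)`, acting on `X`. The action map
`S × X → X` is of class `C^r` over `𝕜`, where regularity on the submanifold `S × X` of
`Mat n × X` is expressed through local extensions: near every point the action map is the
restriction of a `C^r` map defined on an open subset of `Mat n × X` (here `Mat n` is written as the
vector space `Fin n → Fin n → ℂ` of families of entries). For `𝕜 = ℝ`, `r = ∞` this means
smooth and for `𝕜 = ℂ`, `r = ω` it means holomorphic. -/
def IsRegularAction (𝕜 : Type*) [NontriviallyNormedField 𝕜] [NormedSpace 𝕜 E] [NormedSpace 𝕜 ℂ]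
    (r : WithTop ℕ∞) {S : Type*} [TopologicalSpace S] [SMul S X] (ι : S → Mat n) : Prop :=
  ∀ (s₀ : S) (x₀ : X), ∃ F : (Fin n → Fin n → ℂ) × X → X,
    ContMDiffAt (𝓘(𝕜, Fin n → Fin n → ℂ).prod 𝓘(𝕜, E)) 𝓘(𝕜, E) r F (Matrix.of.symm (ι s₀), x₀) ∧
    ∀ᶠ p : S × X in 𝓝 (s₀, x₀), F (Matrix.of.symm (ι p.1), p.2) = p.1 • p.2

variable (G : ClosedSubgroup (Matrix.unitaryGroup (Fin n) ℂ))

/-- `G` acts smoothly on `X` and preserves `J` and `Ω` (hence also the metric `Ω(·, J ·)`), i.e. it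
acts by Kähler isometries. -/
structure IsKaehlerAction [MulAction G X] (Ω : TwoForm E X) : Prop where
  smooth : IsRegularAction (E := E) (X := X) ℝ ∞ (fun u : G => (u : Mat n))
  preserves_J : ∀ (u : G) (x : X) (v : TangentSpace 𝓘(ℝ, E) x),
    mfderiv 𝓘(ℝ, E) 𝓘(ℝ, E) (fun y : X => u • y) x (J x v) =
      J (u • x) (mfderiv 𝓘(ℝ, E) 𝓘(ℝ, E) (fun y : X => u • y) x v)
  preserves_form : ∀ (u : G) (x : X) (v w : TangentSpace 𝓘(ℝ, E) x),
    Ω (u • x) ![mfderiv 𝓘(ℝ, E) 𝓘(ℝ, E) (fun y : X => u • y) x v,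
      mfderiv 𝓘(ℝ, E) 𝓘(ℝ, E) (fun y : X => u • y) x w] = Ω x ![v, w]

/-- The action of `Gᶜ` on `X` is holomorphic and extends the action of `G`. -/
structure IsHolomorphicExtension (E : Type*) [NormedAddCommGroup E] [NormedSpace ℂ E]
    (X : Type*) [TopologicalSpace X] [ChartedSpace E X]
    [MulAction G X] [MulAction (complexification G) X] : Prop where
  holomorphic : IsRegularAction (E := E) (X := X) ℂ ω
    (fun g : complexification G => ((g : GL (Fin n) ℂ) : Mat n))
  extends_action : ∀ (u : G) (x : X), inclG u • x = u • x

variable {G}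

/-- The infinitesimal action `v_ξ(x) = d/dt exp(t ξ) x` at `t = 0`. -/
noncomputable def infAction [MulAction G X] (ξ : lieAlg G) (x : X) : TangentSpace 𝓘(ℝ, E) x :=
  (mfderiv 𝓘(ℝ, ℝ) 𝓘(ℝ, E) (fun t : ℝ => expG (t • ξ) • x) 0 (1 : ℝ) : E)

/-- `μ : X → 𝔤` is an equivariant moment map: `H_ξ = ⟨μ, ξ⟩` is smooth with
`dH_ξ = Ω(v_ξ, ·)`, and `μ(u x) = u μ(x) u⁻¹`. -/
structure IsMomentMap [MulAction G X] (Ω : TwoForm E X) (B : LinearMap.BilinForm ℝ (lieAlg G))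
    (μ : X → lieAlg G) : Prop where
  smooth : ∀ ξ : lieAlg G, ContMDiff 𝓘(ℝ, E) 𝓘(ℝ, ℝ) ∞ (fun x => B (μ x) ξ)
  hamiltonian : ∀ (ξ : lieAlg G) (x : X) (v : TangentSpace 𝓘(ℝ, E) x),
    (mfderiv 𝓘(ℝ, E) 𝓘(ℝ, ℝ) (fun y => B (μ y) ξ) x v : ℝ) = Ω x ![infAction ξ x, v]
  equivariant : ∀ (u : G) (x : X), μ (u • x) = Ad u (μ x)

/-- The function `t ↦ ⟨μ(exp(i t ξ) x), ξ⟩`. -/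
noncomputable def momentAlongRay [MulAction (complexification G) X]
    (B : LinearMap.BilinForm ℝ (lieAlg G)) (μ : X → lieAlg G) (x : X) (ξ : lieAlg G) (t : ℝ) : ℝ :=
  B (μ (expI (t • ξ) • x)) ξ

/-- The `μ`-weight `w_μ(x, ξ) = lim_{t → ∞} ⟨μ(exp(i t ξ) x), ξ⟩`. -/
noncomputable def muWeight [MulAction (complexification G) X]
    (B : LinearMap.BilinForm ℝ (lieAlg G)) (μ : X → lieAlg G) (x : X) (ξ : lieAlg G) : ℝ :=
  limUnder atTop (momentAlongRay B μ x ξ)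

end Action

end MomentWeight

/-! Along the ray `exp(itξ)x` the function `⟨μ, ξ⟩` has derivative `Ω(v_ξ, J v_ξ) ≥ 0`
(`monotone_momentAlongRay`), and it is bounded because `μ` is bounded on the compact `X`; hence the
limit `w` exists.

For the inequality it is enough to find `u ∈ G` such that `u g x` has the same weight `w` for the
same `ξ` (`exists_translate`). Monotonicity and equivariance then give `w ≥ ⟨μ(ugx), ξ⟩ = ⟨u μ(gx)
u⁻¹, ξ⟩ ≥ -|μ(gx)| |ξ|`.

Behind the translate is the decomposition of `Gᶜ` into `G` times the parabolic subgroup of elements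
whose conjugates by `exp(itξ)` stay bounded as `t → ∞`. Only an infinitesimal form is needed: every
`q ∈ 𝔤` has a partner `a ∈ 𝔤` such that conjugating `a + iq` by `exp(itξ)` gives `a(t) + i c(t)`
with `c` bounded for `t ≥ 0` (`exists_bounded_solution`). A curve `u(s)` in `G` solving an ODE
supplies this partner as its logarithmic derivative along `u(s) exp(isq)` (`exists_curve_in_group`).

For `k(t,s) = exp(itξ) u(s) exp(isq)` the moment map equation gives `∂_s ⟨μ(kx), ξ⟩ = ∂_t ⟨μ(kx),
c⟩`. The right side is the `t`-derivative of a bounded function, so `∫₀ᵀ ⟨μ(kx), ξ⟩ dt` varies with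
`s` by an amount bounded independently of `T`. The limit as `t → ∞` therefore cannot depend on `s`
(`limit_eq_of_exchange`). -/

namespace MomentWeight

/-! ### Linear algebra of a positive definite form and a skew endomorphism. -/

section BilinearForms

variable {V : Type*} [AddCommGroup V] [Module ℝ V]

/-- The inner product space core of a positive definite symmetric bilinear form. -/
noncomputable abbrev innerCore (B : LinearMap.BilinForm ℝ V)
    (symm : ∀ x y, B x y = B y x) (pos : ∀ x, x ≠ 0 → 0 < B x x) :
    InnerProductSpace.Core ℝ V where
  inner x y := B x y
  conj_inner_symm x y := symm y x
  re_inner_nonneg x := by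
    rcases eq_or_ne x 0 with rfl | h
    · simp
    · exact (pos x h).le
  add_left x y z := by simp
  smul_left x y r := by simp
  definite x h := by
    by_contra hx
    exact (pos x hx).ne' h

/-- A skew-adjoint endomorphism has an orthonormal basis of eigenvectors of its square. -/
theorem exists_orthonormal_eigenbasis_sq [FiniteDimensional ℝ V] (B : LinearMap.BilinForm ℝ V)
    (symm : ∀ x y, B x y = B y x) (pos : ∀ x, x ≠ 0 → 0 < B x x) (T : V →ₗ[ℝ] V)
    (hT : ∀ x y, B (T x) y = -B x (T y)) :
    ∃ (e : Module.Basis (Fin (Module.finrank ℝ V)) ℝ V) (l : Fin (Module.finrank ℝ V) → ℝ),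
      (∀ i j, B (e i) (e j) = if i = j then 1 else 0) ∧ (∀ i, 0 ≤ l i) ∧
      ∀ i, T (T (e i)) = (-(l i) ^ 2) • e i := by
  let c := innerCore B symm pos
  let : NormedAddCommGroup V := c.toNormedAddCommGroup
  let : InnerProductSpace ℝ V := InnerProductSpace.ofCore c.toCore
  have hS : (T ∘ₗ T).IsSymmetric := by
    intro x y
    change B (T (T x)) y = B x (T (T y))
    rw [hT, hT, neg_neg]
  -- The square root is genuine: `B(T²v, v) = -B(Tv, Tv) ≤ 0`, so the eigenvalues of `T²` are
  -- nonpositive.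
  refine ⟨(hS.eigenvectorBasis rfl).toBasis, fun i => √(-(hS.eigenvalues rfl i)), ?_, ?_, ?_⟩
  · intro i j
    have h := orthonormal_iff_ite.1 (hS.eigenvectorBasis rfl).orthonormal i j
    simp only [OrthonormalBasis.coe_toBasis]
    exact h
  · intro i; positivity
  · intro i
    have h := hS.apply_eigenvectorBasis rfl i
    set v := hS.eigenvectorBasis rfl i
    have hv : B v v = 1 := by
      have h := orthonormal_iff_ite.1 (hS.eigenvectorBasis rfl).orthonormal i i
      rw [if_pos rfl] at h
      exact h
    have h1 : B (T (T v)) v = hS.eigenvalues rfl i := by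
      have : T (T v) = hS.eigenvalues rfl i • v := h
      rw [this]; simp [hv]
    have h2 : 0 ≤ B (T v) (T v) := c.re_inner_nonneg (T v)
    rw [hT] at h1
    rw [Real.sq_sqrt (by linarith), neg_neg]
    simpa using h

theorem abs_apply_le_sqrt_mul_sqrt (B : LinearMap.BilinForm ℝ V)
    (symm : ∀ x y, B x y = B y x) (pos : ∀ x, x ≠ 0 → 0 < B x x) (x y : V) :
    |B x y| ≤ √(B x x) * √(B y y) := by
  let c := innerCore B symm pos
  let : NormedAddCommGroup V := c.toNormedAddCommGroup
  let : InnerProductSpace ℝ V := InnerProductSpace.ofCore c.toCore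
  exact abs_real_inner_le_norm x y

theorem eq_sum_of_orthonormal {ι : Type*} [Fintype ι] [DecidableEq ι] (B : LinearMap.BilinForm ℝ V)
    (e : Module.Basis ι ℝ V) (he : ∀ i j, B (e i) (e j) = if i = j then 1 else 0) (x : V) :
    x = ∑ i, B x (e i) • e i := by
  conv_lhs => rw [← e.sum_repr x]
  refine Finset.sum_congr rfl fun i _ => ?_
  have h := congrArg (fun y => B y (e i)) (e.sum_repr x)
  simp only [map_sum, map_smul, LinearMap.sum_apply, LinearMap.smul_apply, he, smul_eq_mul,
    mul_ite, mul_one, mul_zero, Finset.sum_ite_eq', Finset.mem_univ, if_true] at h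
  rw [h]

end BilinearForms

/-! ### The adjoint representation and invariance of the inner product. -/

section LieAlgebra

open scoped Matrix.Norms.L2Operator

variable {n : ℕ} {G : ClosedSubgroup (Matrix.unitaryGroup (Fin n) ℂ)}

theorem star_lieAlg (ξ : lieAlg G) : star (ξ : Mat n) = -(ξ : Mat n) :=
  star_eq_neg_of_exp_mem_unitary fun t => by
    rw [coe_smul_mat]; exact (ξ.2 t).1

theorem hasDerivAt_exp_smul_mat (A : Mat n) (t : ℝ) :
    HasDerivAt (fun t : ℝ => NormedSpace.exp (t • A)) (A * NormedSpace.exp (t • A)) t :=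
  hasDerivAt_exp_smul_const' A t

theorem coe_expG (ξ : lieAlg G) : ((expG ξ : G) : Mat n) = NormedSpace.exp (ξ : Mat n) := rfl

theorem star_expG (ξ : lieAlg G) :
    star ((expG ξ : G) : Mat n) = NormedSpace.exp (-(ξ : Mat n)) := by
  have h : star (NormedSpace.exp (ξ : Mat n)) = NormedSpace.exp (star (ξ : Mat n)) :=
    (NormedSpace.star_exp _)
  rw [coe_expG, h, star_lieAlg]

theorem expG_neg (ξ : lieAlg G) : expG (-ξ) = (expG ξ)⁻¹ := by
  apply Subtype.ext
  apply Subtype.ext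
  exact (star_expG ξ).symm

@[simp] theorem coe_Ad (u : G) (ξ : lieAlg G) :
    (Ad u ξ : Mat n) = (u : Mat n) * ξ * star (u : Mat n) := rfl

theorem Ad_mul (u v : G) (ξ : lieAlg G) : Ad (u * v) ξ = Ad u (Ad v ξ) := by
  apply Subtype.ext
  simp [mul_assoc]

theorem Ad_one (ξ : lieAlg G) : Ad (1 : G) ξ = ξ := by
  apply Subtype.ext
  simp

theorem exists_retraction (G : ClosedSubgroup (Matrix.unitaryGroup (Fin n) ℂ)) :
    ∃ R : Mat n →ₗ[ℝ] lieAlg G, R ∘ₗ (lieAlg G).subtype = LinearMap.id :=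
  LinearMap.exists_leftInverse_of_injective _ (Submodule.ker_subtype _)

/-- A linear retraction of the space of matrices onto `𝔤`. -/
noncomputable def retraction (G : ClosedSubgroup (Matrix.unitaryGroup (Fin n) ℂ)) :
    Mat n →L[ℝ] lieAlg G :=
  LinearMap.toContinuousLinearMap (exists_retraction G).choose

theorem retraction_coe (ξ : lieAlg G) : retraction G (ξ : Mat n) = ξ :=
  LinearMap.congr_fun (exists_retraction G).choose_spec ξ

theorem deriv_mem_submodule {F : Type*} [NormedAddCommGroup F] [NormedSpace ℝ F]
    [FiniteDimensional ℝ F] (S : Submodule ℝ F) {γ : ℝ → F} {γ' : F} {r : ℝ}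
    (h : HasDerivAt γ γ' r) (hS : ∀ t, γ t ∈ S) : γ' ∈ S := by
  refine (Submodule.closed_of_finiteDimensional S).mem_of_tendsto h.tendsto_slope
    (Eventually.of_forall fun t => ?_)
  exact S.smul_mem _ (S.sub_mem (hS _) (hS _))

theorem hasDerivAt_coe_Ad_expG (ξ η : lieAlg G) :
    HasDerivAt (fun t : ℝ => (Ad (expG (t • ξ)) η : Mat n))
      ((ξ : Mat n) * η - (η : Mat n) * ξ) 0 := by
  have h1 := hasDerivAt_exp_smul_mat (ξ : Mat n) 0
  have h2 := hasDerivAt_exp_smul_mat (-(ξ : Mat n)) 0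
  have h := (h1.mul_const (η : Mat n)).mul h2
  refine (h.congr_deriv ?_).congr_of_eventuallyEq (Eventually.of_forall fun t => ?_)
  · simp [NormedSpace.exp_zero, sub_eq_add_neg]
  · simp only [coe_Ad, star_expG]
    simp [coe_expG]

theorem bracket_mem (ξ η : lieAlg G) : (ξ : Mat n) * η - (η : Mat n) * ξ ∈ lieAlg G :=
  deriv_mem_submodule _ (hasDerivAt_coe_Ad_expG ξ η) fun _ => Subtype.prop _

/-- The bracket with `ξ`, as an endomorphism of `𝔤`. -/
noncomputable def ad (ξ : lieAlg G) : lieAlg G →ₗ[ℝ] lieAlg G where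
  toFun η := ⟨(ξ : Mat n) * η - (η : Mat n) * ξ, bracket_mem ξ η⟩
  map_add' η ζ := by
    apply Subtype.ext
    simp only [Submodule.coe_add]
    noncomm_ring
  map_smul' c η := by
    apply Subtype.ext
    simp [smul_sub]

theorem coe_ad (ξ η : lieAlg G) : (ad ξ η : Mat n) = (ξ : Mat n) * η - (η : Mat n) * ξ := rfl

theorem hasDerivAt_Ad_expG (ξ η : lieAlg G) :
    HasDerivAt (fun t : ℝ => Ad (expG (t • ξ)) η) (ad ξ η) 0 := by
  have h := (retraction G).hasFDerivAt.comp_hasDerivAt 0 (hasDerivAt_coe_Ad_expG ξ η)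
  refine (h.congr_deriv ?_).congr_of_eventuallyEq (Eventually.of_forall fun t => ?_)
  · exact retraction_coe (ad ξ η)
  · exact (retraction_coe _).symm

variable {B : LinearMap.BilinForm ℝ (lieAlg G)}

theorem IsInvariantInner.hasDerivAt_left (B : LinearMap.BilinForm ℝ (lieAlg G))
    {γ : ℝ → lieAlg G} {γ' : lieAlg G} {t : ℝ} (h : HasDerivAt γ γ' t) (η : lieAlg G) :
    HasDerivAt (fun t => B (γ t) η) (B γ' η) t :=
  (LinearMap.toContinuousLinearMap (B.flip η)).hasFDerivAt.comp_hasDerivAt t h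

theorem IsInvariantInner.Ad_left (hB : IsInvariantInner B) (u : G) (η ζ : lieAlg G) :
    B (Ad u η) ζ = B η (Ad u⁻¹ ζ) := by
  rw [← hB.invariant u⁻¹, ← Ad_mul, inv_mul_cancel, Ad_one]

/-- Derivative at `t = 0` of the identity `⟨Ad(exp tξ) η, ζ⟩ = ⟨η, Ad(exp(-tξ)) ζ⟩`. -/
theorem IsInvariantInner.ad_left (hB : IsInvariantInner B) (ξ η ζ : lieAlg G) :
    B (ad ξ η) ζ = -B η (ad ξ ζ) := by
  have h1 := IsInvariantInner.hasDerivAt_left B (hasDerivAt_Ad_expG ξ η) ζ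
  have h2 := IsInvariantInner.hasDerivAt_left B (hasDerivAt_Ad_expG (-ξ) ζ) η
  have h3 : (fun t : ℝ => B (Ad (expG (t • -ξ)) ζ) η) = fun t => B (Ad (expG (t • ξ)) η) ζ := by
    funext t
    rw [hB.Ad_left, smul_neg, expG_neg, inv_inv, hB.symm]
  rw [h3] at h2
  rw [h1.unique h2, hB.symm η, ← LinearMap.neg_apply, ← map_neg]
  congr 2
  apply Subtype.ext
  simp [coe_ad]
  abel

end LieAlgebra

/-! ### Orbit maps of `Gᶜ` as functions of matrices. -/

section LocalExtension

variable {n : ℕ} {G : ClosedSubgroup (Matrix.unitaryGroup (Fin n) ℂ)}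

/-- The matrix underlying an element of the complexification. -/
abbrev toMat (k : complexification G) : Mat n := ((k : GL (Fin n) ℂ) : Mat n)

-- Lets continuity of a curve in `Gᶜ` be checked on its matrix entries.
open scoped Matrix.Norms.L2Operator in
theorem isInducing_toMat : Topology.IsInducing (toMat : complexification G → Mat n) :=
  (Units.isOpenEmbedding_val (R := Mat n)).isInducing.comp Topology.IsInducing.subtypeVal

theorem toMat_inclG (u : G) : toMat (inclG u) = (u : Mat n) := rfl

theorem toMat_expI (ξ : lieAlg G) : toMat (expI ξ) = NormedSpace.exp (Complex.I • (ξ : Mat n)) := rfl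

theorem toMat_mul (k l : complexification G) : toMat (k * l) = toMat k * toMat l := rfl

/-- The matrices as families of entries. -/
def entries (n : ℕ) : Mat n →L[ℝ] (Fin n → Fin n → ℂ) where
  toFun := Matrix.of.symm
  map_add' _ _ := rfl
  map_smul' _ _ := rfl
  cont := continuous_id

variable {E : Type*} [NormedAddCommGroup E] [NormedSpace ℂ E]
  {X : Type*} [TopologicalSpace X] [ChartedSpace E X]

theorem mfderiv_curve_eq {c : ℝ → X} {y : X} (h : c 0 = y) (hc : ContinuousAt c 0) {w : E}
    (hd : HasDerivAt (extChartAt 𝓘(ℝ, E) y ∘ c) w 0) :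
    (mfderiv 𝓘(ℝ, ℝ) 𝓘(ℝ, E) c 0 (1 : ℝ) : E) = w := by
  subst h
  have h1 : HasMFDerivAt 𝓘(ℝ, ℝ) 𝓘(ℝ, E) c 0 (ContinuousLinearMap.toSpanSingleton ℝ w : ℝ →L[ℝ] E) := by
    refine ⟨hc, ?_⟩
    exact hd.hasFDerivAt.hasFDerivWithinAt
  rw [h1.mfderiv]
  exact one_smul ℝ w

variable [MulAction G X] [MulAction (complexification G) X]

/-- Freezing `x` in the local holomorphic extension of the action leaves a function `f` of matrices.
That `D` is complex linear is what later turns the direction `iβ` into `J v_β`. -/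
theorem exists_holomorphic_orbit_map (hGc : IsHolomorphicExtension G E X)
    (k₀ : complexification G) (x : X) :
    ∃ (f : (Fin n → Fin n → ℂ) → X) (D : (Fin n → Fin n → ℂ) →L[ℂ] E),
      (∀ᶠ k in 𝓝 k₀, f (entries n (toMat k)) = k • x) ∧
      ContMDiffAt 𝓘(ℝ, Fin n → Fin n → ℂ) 𝓘(ℝ, E) ∞ f (entries n (toMat k₀)) ∧
      HasFDerivAt (extChartAt 𝓘(ℝ, E) (f (entries n (toMat k₀))) ∘ f) (D.restrictScalars ℝ)
        (entries n (toMat k₀)) := by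
  obtain ⟨F, hF, hF'⟩ := hGc.holomorphic k₀ x
  set K₀ := entries n (toMat k₀)
  have hf : ContMDiffAt 𝓘(ℂ, Fin n → Fin n → ℂ) 𝓘(ℂ, E) ω (fun M => F (M, x)) K₀ :=
    ContMDiffAt.comp (I' := 𝓘(ℂ, Fin n → Fin n → ℂ).prod 𝓘(ℂ, E)) K₀ hF
      (contMDiffAt_id.prodMk contMDiffAt_const)
  rw [contMDiffAt_iff_target] at hf
  have hg : ContDiffAt ℂ ω (extChartAt 𝓘(ℝ, E) (F (K₀, x)) ∘ fun M => F (M, x)) K₀ :=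
    contMDiffAt_iff_contDiffAt.1 hf.2
  refine ⟨fun M => F (M, x), fderiv ℂ _ K₀, ?_, ?_,
    (hg.differentiableAt (by simp)).hasFDerivAt.restrictScalars ℝ⟩
  · exact (continuousAt_id.prodMk continuousAt_const : ContinuousAt
      (fun k : complexification G => (k, x)) k₀).eventually hF'
  · rw [contMDiffAt_iff_target]
    refine ⟨hf.1, contMDiffAt_iff_contDiffAt.2 ?_⟩
    exact (hg.restrict_scalars ℝ).of_le (by exact_mod_cast le_top)

/-- Chain rule along the curve `exp(tα) k₀`, whose velocity at `0` is the matrix `α k₀`. -/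
theorem infAction_eq (hGc : IsHolomorphicExtension G E X) {k₀ : complexification G} {x : X}
    {f : (Fin n → Fin n → ℂ) → X} {D : (Fin n → Fin n → ℂ) →L[ℂ] E}
    (hf : ∀ᶠ k in 𝓝 k₀, f (entries n (toMat k)) = k • x)
    (hfc : ContinuousAt f (entries n (toMat k₀)))
    (hD : HasFDerivAt (extChartAt 𝓘(ℝ, E) (f (entries n (toMat k₀))) ∘ f) (D.restrictScalars ℝ)
      (entries n (toMat k₀))) (α : lieAlg G) :
    (infAction α (f (entries n (toMat k₀))) : E) = D (entries n ((α : Mat n) * toMat k₀)) := by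
  open scoped Matrix.Norms.L2Operator in
  have hc : HasDerivAt (fun t : ℝ => entries n (toMat (inclG (expG (t • α)) * k₀)))
      (entries n ((α : Mat n) * toMat k₀)) 0 := by
    refine ((entries n).hasFDerivAt.comp_hasDerivAt 0
      ((hasDerivAt_exp_smul_mat (α : Mat n) 0).mul_const (toMat k₀))).congr_deriv ?_
    simp [NormedSpace.exp_zero]
  have h0 : inclG (expG ((0 : ℝ) • α)) * k₀ = k₀ := by
    apply Subtype.ext
    apply Units.ext
    change NormedSpace.exp (((0 : ℝ) • α : lieAlg G) : Mat n) * _ = _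
    simp [NormedSpace.exp_zero]
  have hk : ContinuousAt (fun t : ℝ => inclG (expG (t • α)) * k₀) 0 := by
    rw [isInducing_toMat.continuousAt_iff]
    exact hc.continuousAt
  have hk' : Tendsto (fun t : ℝ => inclG (expG (t • α)) * k₀) (𝓝 0) (𝓝 k₀) := by
    have := hk.tendsto
    rwa [h0] at this
  have hev : (fun t : ℝ => expG (t • α) • f (entries n (toMat k₀))) =ᶠ[𝓝 0]
      fun t => f (entries n (toMat (inclG (expG (t • α)) * k₀))) := by
    filter_upwards [hk'.eventually hf] with t ht
    rw [ht, hf.self_of_nhds, mul_smul, hGc.extends_action]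
  have hcont : ContinuousAt (fun t : ℝ => f (entries n (toMat (inclG (expG (t • α)) * k₀)))) 0 :=
    ContinuousAt.comp_of_eq hfc hc.continuousAt (by rw [h0])
  refine mfderiv_curve_eq (y := f (entries n (toMat k₀))) ?_ (hcont.congr_of_eventuallyEq hev) ?_
  · exact hev.self_of_nhds.trans (by beta_reduce; rw [h0])
  · refine HasDerivAt.congr_of_eventuallyEq (f := (extChartAt 𝓘(ℝ, E) (f (entries n (toMat k₀))) ∘ f)
      ∘ fun t : ℝ => entries n (toMat (inclG (expG (t • α)) * k₀))) ?_ ?_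
    · exact hD.comp_hasDerivAt_of_eq 0 hc (by rw [h0])
    · filter_upwards [hev] with t ht
      simp only [Function.comp_apply]
      rw [ht]

variable {Ω : TwoForm E X} {B : LinearMap.BilinForm ℝ (lieAlg G)} {μ : X → lieAlg G}

/-- Near `k₀`, the function `k ↦ ⟨μ (k x), γ⟩` on `Gᶜ` extends to a smooth function of matrices,
whose derivative is given by the moment map equation. -/
theorem exists_moment_extension (hGc : IsHolomorphicExtension G E X) (hμ : IsMomentMap Ω B μ)
    (k₀ : complexification G) (x : X) (γ : lieAlg G) :
    ∃ h : (Fin n → Fin n → ℂ) → ℝ, ContDiffAt ℝ ∞ h (entries n (toMat k₀)) ∧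
      (∀ᶠ k in 𝓝 k₀, h (entries n (toMat k)) = B (μ (k • x)) γ) ∧
      ∀ α β : lieAlg G, fderiv ℝ h (entries n (toMat k₀))
        (entries n (((α : Mat n) + Complex.I • (β : Mat n)) * toMat k₀)) =
        Ω (k₀ • x) ![infAction γ (k₀ • x), infAction α (k₀ • x) +
          J (k₀ • x) (infAction β (k₀ • x))] := by
  obtain ⟨f, D, hf, hfs, hD⟩ := exists_holomorphic_orbit_map hGc k₀ x
  refine ⟨fun M => B (μ (f M)) γ, ?_, ?_, fun α β => ?_⟩
  · exact contMDiffAt_iff_contDiffAt.1 ((hμ.smooth γ).contMDiffAt.comp _ hfs)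
  · filter_upwards [hf] with k hk
    rw [hk]
  · rw [← hf.self_of_nhds]
    have h1 : HasMFDerivAt 𝓘(ℝ, Fin n → Fin n → ℂ) 𝓘(ℝ, E) f (entries n (toMat k₀))
        (D.restrictScalars ℝ) := by
      refine ⟨hfs.continuousAt, ?_⟩
      exact hD.hasFDerivWithinAt
    have h2 := ((hμ.smooth γ).mdifferentiable (by simp)
      (f (entries n (toMat k₀)))).hasMFDerivAt
    obtain ⟨L, hL⟩ : ∃ L : E →L[ℝ] ℝ, L = mfderiv 𝓘(ℝ, E) 𝓘(ℝ, ℝ) (fun y => B (μ y) γ)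
      (f (entries n (toMat k₀))) := ⟨_, rfl⟩
    have h3 : HasFDerivAt (fun M => B (μ (f M)) γ) (L.comp (D.restrictScalars ℝ))
        (entries n (toMat k₀)) := by
      rw [hL]
      exact hasMFDerivAt_iff_hasFDerivAt.1 (h2.comp _ h1)
    have hα := infAction_eq hGc hf hfs.continuousAt hD α
    have hβ := congrArg (fun w : E => Complex.I • w)
      (infAction_eq hGc hf hfs.continuousAt hD β)
    -- Complex linearity of `D`: the direction `(α + iβ)k₀` is sent to `v_α + J v_β`.
    have h4 : (infAction α (f (entries n (toMat k₀))) +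
        J (f (entries n (toMat k₀))) (infAction β (f (entries n (toMat k₀)))) :
          TangentSpace 𝓘(ℝ, E) (f (entries n (toMat k₀)))) =
        D (entries n (((α : Mat n) + Complex.I • (β : Mat n)) * toMat k₀)) := by
      refine (congrArg₂ (fun v w : E => v + w) hα hβ).trans ?_
      rw [← map_smul, ← map_add, add_mul, smul_mul_assoc]
      rfl
    rw [h3.fderiv]
    refine Eq.trans ((congrArg (fun L : E →L[ℝ] ℝ => L (D _)) hL).trans (hμ.hamiltonian γ _ _)) ?_
    exact congrArg (fun w : TangentSpace 𝓘(ℝ, E) (f (entries n (toMat k₀))) =>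
      Ω (f (entries n (toMat k₀))) ![infAction γ (f (entries n (toMat k₀))), w]) h4.symm

end LocalExtension

/-! ### Forward-bounded solutions of the conjugation flow. -/

section SkewFlow

variable {V : Type*} [NormedAddCommGroup V] [NormedSpace ℝ V] [FiniteDimensional ℝ V]

/-- For a skew-adjoint `T`, every initial value `c (0) = q` extends to a solution of
`c' = T a`, `a' = - T c` that stays bounded in forward time. -/
theorem exists_bounded_solution (B : LinearMap.BilinForm ℝ V)
    (symm : ∀ x y, B x y = B y x) (pos : ∀ x, x ≠ 0 → 0 < B x x) (T : V →ₗ[ℝ] V)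
    (hT : ∀ x y, B (T x) y = -B x (T y)) :
    ∃ a c : ℝ → V →ₗ[ℝ] V, c 0 = LinearMap.id ∧
      (∀ q t, HasDerivAt (fun t => c t q) (T (a t q)) t) ∧
      (∀ q t, HasDerivAt (fun t => a t q) (-T (c t q)) t) ∧
      ∃ K, ∀ t, 0 ≤ t → ∀ p q, |B p (c t q)| ≤ K * (√(B p p) * √(B q q)) := by
  obtain ⟨e, l, he, hl, hTe⟩ := exists_orthonormal_eigenbasis_sq B symm pos T hT
  have hTe0 : ∀ i, l i = 0 → T (e i) = 0 := by
    intro i hi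
    by_contra h
    have h1 := pos _ h
    rw [hT, hTe, hi] at h1
    simp at h1
  have hexp : ∀ i t, HasDerivAt (fun t : ℝ => Real.exp (-l i * t))
      (-l i * Real.exp (-l i * t)) t := by
    intro i t
    simpa [mul_comm] using ((hasDerivAt_id t).const_mul (-l i)).exp
  -- On the eigenvector `e i` take `c = exp(-lt) e_i` and `a = l⁻¹ exp(-lt) T e_i`, the solution
  -- without the growing exponential. If `l = 0` then `T e_i = 0`, so the convention `0⁻¹ = 0` does
  -- no harm.
  refine ⟨fun t => ∑ i, ((l i)⁻¹ * Real.exp (-l i * t)) • (B.flip (e i)).smulRight (T (e i)),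
    fun t => ∑ i, Real.exp (-l i * t) • (B.flip (e i)).smulRight (e i), ?_, ?_, ?_, ?_⟩
  · refine LinearMap.ext fun x => ?_
    simpa using (eq_sum_of_orthonormal B e he x).symm
  · intro q t
    simp only [LinearMap.sum_apply, LinearMap.smul_apply, LinearMap.smulRight_apply, map_sum,
      map_smul, hTe]
    refine HasDerivAt.fun_sum fun i _ => ((hexp i t).smul_const _).congr_deriv ?_
    rw [smul_smul, smul_smul, smul_smul]
    congr 1
    rcases eq_or_ne (l i) 0 with h | h
    · simp [h]
    · field_simp
  · intro q t
    simp only [LinearMap.sum_apply, LinearMap.smul_apply, LinearMap.smulRight_apply, map_sum,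
      map_smul, ← Finset.sum_neg_distrib]
    refine HasDerivAt.fun_sum fun i _ => (((hexp i t).const_mul _).smul_const _).congr_deriv ?_
    rcases eq_or_ne (l i) 0 with h | h
    · simp [h, hTe0 i h]
    · rw [← neg_smul]
      congr 1
      field_simp
  · refine ⟨Module.finrank ℝ V, fun t ht p q => ?_⟩
    simp only [LinearMap.sum_apply, LinearMap.smul_apply, LinearMap.smulRight_apply, map_sum,
      map_smul, smul_eq_mul]
    refine (Finset.abs_sum_le_sum_abs _ _).trans ?_
    refine (Finset.sum_le_card_nsmul _ _ (√(B p p) * √(B q q)) fun i _ => ?_).trans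
      (le_of_eq (by simp))
    have h1 : ∀ p, |B p (e i)| ≤ √(B p p) := fun p => by
      simpa [he] using abs_apply_le_sqrt_mul_sqrt B symm pos p (e i)
    have h2 : Real.exp (-l i * t) ≤ 1 := by
      rw [Real.exp_le_one_iff]
      nlinarith [mul_nonneg (hl i) ht]
    have h3 : |B.flip (e i) q| ≤ √(B q q) := h1 q
    rw [abs_mul, abs_mul, Real.abs_exp]
    calc _ ≤ 1 * (√(B q q) * √(B p p)) := by gcongr; exact h1 p
      _ = _ := by ring

/-- A product rule that needs only the pairings of `m` with fixed vectors to be differentiable,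
which is the form of regularity a moment map comes with. -/
theorem hasDerivAt_bilin_apply (B : LinearMap.BilinForm ℝ V) {m c : ℝ → V} {c' : V} {D : V → ℝ}
    {t : ℝ} (hm : ∀ γ, HasDerivAt (fun r => B (m r) γ) (D γ) t) (hc : HasDerivAt c c' t) :
    HasDerivAt (fun r => B (m r) (c r)) (B (m t) c' + D (c t)) t := by
  set e := Module.finBasis ℝ V
  have hexp : ∀ p x : V, B p x = ∑ i, e.repr x i * B p (e i) := by
    intro p x
    conv_lhs => rw [← e.sum_repr x]
    simp only [map_sum, map_smul, smul_eq_mul]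
  have hD : D (c t) = ∑ i, e.repr (c t) i * D (e i) := by
    refine (hm (c t)).unique ?_
    simp only [hexp _ (c t)]
    exact HasDerivAt.fun_sum fun i _ => (hm (e i)).const_mul _
  have hci : ∀ i, HasDerivAt (fun r => e.repr (c r) i) (e.repr c' i) t := fun i =>
    (LinearMap.toContinuousLinearMap (e.coord i)).hasFDerivAt.comp_hasDerivAt t hc
  simp only [hexp (m _) (c _)]
  refine (HasDerivAt.fun_sum fun i _ => (hci i).mul (hm (e i))).congr_deriv ?_
  rw [hD, hexp, Finset.sum_add_distrib]

end SkewFlow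

/-! ### Boundedness of the moment map. -/

section ActionBasics

variable {n : ℕ} {G : ClosedSubgroup (Matrix.unitaryGroup (Fin n) ℂ)}
  {E : Type*} [NormedAddCommGroup E] [NormedSpace ℂ E]
  {X : Type*} [TopologicalSpace X] [ChartedSpace E X] [MulAction G X]

theorem expG_zero : expG (0 : lieAlg G) = 1 := by
  apply Subtype.ext
  apply Subtype.ext
  change NormedSpace.exp ((0 : lieAlg G) : Mat n) = 1
  simp [NormedSpace.exp_zero]

theorem infAction_zero (y : X) : infAction (0 : lieAlg G) y = (0 : TangentSpace 𝓘(ℝ, E) y) := by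
  have h : (fun t : ℝ => expG (t • (0 : lieAlg G)) • y) = fun _ => y := by
    funext t
    rw [smul_zero, expG_zero, one_smul]
  unfold infAction
  rw [h, mfderiv_const]
  rfl

variable {Ω : TwoForm E X} {B : LinearMap.BilinForm ℝ (lieAlg G)} {μ : X → lieAlg G}

/-- The coordinates of `μ` in an orthonormal basis are the functions `H_ξ`, so `μ` is continuous on
a compact space. -/
theorem exists_sqrt_moment_le [CompactSpace X] (hμ : IsMomentMap Ω B μ) (hB : IsInvariantInner B) :
    ∃ M, ∀ y, √(B (μ y) (μ y)) ≤ M := by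
  set e := Module.finBasis ℝ (lieAlg G)
  have hc : Continuous μ := by
    obtain ⟨e, l, he, -⟩ := exists_orthonormal_eigenbasis_sq B hB.symm hB.pos 0 (by simp)
    have : μ = fun y => ∑ i, B (μ y) (e i) • e i := funext fun y => eq_sum_of_orthonormal B e he _
    rw [this]
    exact continuous_finsetSum _ fun i _ => (hμ.smooth (e i)).continuous.smul continuous_const
  have hB2 : Continuous fun p : lieAlg G => B p p := by
    have hexp : (fun p : lieAlg G => B p p) = fun p => ∑ i, e.repr p i * B p (e i) := by
      funext p
      conv_lhs => enter [2]; rw [← e.sum_repr p]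
      simp only [map_sum, map_smul, smul_eq_mul]
    rw [hexp]
    exact continuous_finsetSum _ fun i _ =>
      (LinearMap.continuous_of_finiteDimensional (e.coord i)).mul
        (LinearMap.continuous_of_finiteDimensional (B.flip (e i)))
  obtain ⟨M, hM⟩ := isCompact_univ.bddAbove_image
    (f := fun y => √(B (μ y) (μ y))) ((hB2.comp hc).sqrt).continuousOn
  exact ⟨M, fun y => hM ⟨y, trivial, rfl⟩⟩

end ActionBasics

/-! ### Derivatives of the moment map along curves in `Gᶜ`. -/

section MomentDerivative

open scoped Matrix.Norms.L2Operator

variable {n : ℕ} {G : ClosedSubgroup (Matrix.unitaryGroup (Fin n) ℂ)}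
  {E : Type*} [NormedAddCommGroup E] [NormedSpace ℂ E]
  {X : Type*} [TopologicalSpace X] [ChartedSpace E X]
  [MulAction G X] [MulAction (complexification G) X]
  {Ω : TwoForm E X} {B : LinearMap.BilinForm ℝ (lieAlg G)} {μ : X → lieAlg G}

/-- Stated for a general parameter space so that it covers the two variables `(t, s)` jointly. -/
theorem contDiffAt_moment (hGc : IsHolomorphicExtension G E X) (hμ : IsMomentMap Ω B μ)
    {N : Type*} [NormedAddCommGroup N] [NormedSpace ℝ N] {k : N → complexification G} {p : N}
    (hk : ContDiffAt ℝ 1 (fun p => toMat (k p)) p) (x : X) (γ : lieAlg G) :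
    ContDiffAt ℝ 1 (fun p => B (μ (k p • x)) γ) p := by
  obtain ⟨h, hh, hev, -⟩ := exists_moment_extension hGc hμ (k p) x γ
  have hkc : ContinuousAt k p := isInducing_toMat.continuousAt_iff.2 hk.continuousAt
  have h1 : ContDiffAt ℝ 1 (fun p => h (entries n (toMat (k p)))) p :=
    ContDiffAt.comp p (hh.of_le (by simp)) ((entries n).contDiff.contDiffAt.comp p hk)
  exact h1.congr_of_eventuallyEq (by
    filter_upwards [hkc.eventually hev] with q hq using hq.symm)

theorem hasDerivAt_moment (hGc : IsHolomorphicExtension G E X) (hμ : IsMomentMap Ω B μ)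
    {k : ℝ → complexification G} {r : ℝ} {α β : lieAlg G}
    (hk : HasDerivAt (fun r => toMat (k r))
      (((α : Mat n) + Complex.I • (β : Mat n)) * toMat (k r)) r) (x : X) (γ : lieAlg G) :
    HasDerivAt (fun r => B (μ (k r • x)) γ) (Ω (k r • x) ![infAction γ (k r • x),
      infAction α (k r • x) + J (k r • x) (infAction β (k r • x))]) r := by
  obtain ⟨h, hh, hev, hd⟩ := exists_moment_extension hGc hμ (k r) x γ
  have hkc : ContinuousAt k r := isInducing_toMat.continuousAt_iff.2 hk.continuousAt
  rw [← hd α β]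
  have h1 := (hh.differentiableAt (by simp)).hasFDerivAt.comp_hasDerivAt r
    ((entries n).hasFDerivAt.comp_hasDerivAt r hk)
  exact h1.congr_of_eventuallyEq (by
    filter_upwards [hkc.eventually hev] with q hq using hq.symm)

theorem hasDerivAt_expI (ξ : lieAlg G) (t : ℝ) :
    HasDerivAt (fun t : ℝ => toMat (expI (t • ξ))) (Complex.I • (ξ : Mat n) * toMat (expI (t • ξ)))
      t := by
  have h := hasDerivAt_exp_smul_mat (Complex.I • (ξ : Mat n)) t
  simpa [toMat_expI, smul_comm Complex.I] using h

theorem hasDerivAt_moment_expI (hGc : IsHolomorphicExtension G E X) (hμ : IsMomentMap Ω B μ)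
    (ξ : lieAlg G) (k : complexification G) (x : X) (γ : lieAlg G) (t : ℝ) :
    HasDerivAt (fun t : ℝ => B (μ ((expI (t • ξ) * k) • x)) γ)
      (Ω ((expI (t • ξ) * k) • x) ![infAction γ ((expI (t • ξ) * k) • x),
        J ((expI (t • ξ) * k) • x) (infAction ξ ((expI (t • ξ) * k) • x))]) t := by
  have h := hasDerivAt_moment (α := 0) (β := ξ) (k := fun t : ℝ => expI (t • ξ) * k) hGc hμ
    (((hasDerivAt_expI ξ t).mul_const (toMat k)).congr_deriv (by simp [toMat_mul, mul_assoc])) x γ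
  rwa [infAction_zero, zero_add] at h

theorem twoForm_swap (Ω : TwoForm E X) (y : X) (v w : TangentSpace 𝓘(ℝ, E) y) :
    Ω y ![v, w] = -Ω y ![w, v] := by
  have h := (Ω y).map_swap ![w, v] (i := 0) (j := 1) (by simp)
  have hs : ![w, v] ∘ Equiv.swap (0 : Fin 2) 1 = ![v, w] := by
    ext i
    fin_cases i <;> simp
  rw [hs] at h
  exact h

/-- Differentiate the equivariance `μ(exp(tξ)y) = Ad(exp tξ) μ(y)` at `t = 0` and compare with the
moment map equation. -/
theorem twoForm_infAction (hGc : IsHolomorphicExtension G E X) (hμ : IsMomentMap Ω B μ)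
    (hB : IsInvariantInner B) (ξ α : lieAlg G) (y : X) :
    Ω y ![infAction ξ y, infAction α y] = B (μ y) (ad ξ α) := by
  have hk : HasDerivAt (fun t : ℝ => toMat (inclG (expG (t • ξ))))
      (((ξ : Mat n) + Complex.I • ((0 : lieAlg G) : Mat n)) * toMat (inclG (expG ((0 : ℝ) • ξ))))
      0 :=
    (hasDerivAt_exp_smul_mat (ξ : Mat n) 0).congr_deriv (by simp [toMat_inclG, coe_expG])
  have h0 : inclG (expG ((0 : ℝ) • ξ)) • y = y := by
    rw [hGc.extends_action, zero_smul, expG_zero, one_smul]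
  have h := hasDerivAt_moment hGc hμ hk y α
  rw [h0, infAction_zero, map_zero, add_zero] at h
  have h2 := IsInvariantInner.hasDerivAt_left B (hasDerivAt_Ad_expG ξ (μ y)) α
  have h3 : (fun t : ℝ => B (μ (inclG (expG (t • ξ)) • y)) α) =
      fun t => B (Ad (expG (t • ξ)) (μ y)) α := by
    funext t
    rw [hGc.extends_action, hμ.equivariant]
  rw [h3] at h
  rw [twoForm_swap, h.unique h2, hB.ad_left, neg_neg]

/-- Symmetry of the metric exchanges `ξ` and `β` in the second term. With `α = a(t)` and `β = c(t)`
the right side becomes `d/dt ⟨μ, c⟩` along `exp(itξ)`, since `c' = [ξ, a]`. -/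
theorem twoForm_infAction_add (hΩ : IsKaehlerForm Ω) (hGc : IsHolomorphicExtension G E X)
    (hμ : IsMomentMap Ω B μ) (hB : IsInvariantInner B) (ξ α β : lieAlg G) (y : X) :
    Ω y ![infAction ξ y, infAction α y + J y (infAction β y)] =
      B (μ y) (ad ξ α) + Ω y ![infAction β y, J y (infAction ξ y)] := by
  rw [← twoForm_infAction hGc hμ hB, hΩ.symm y (infAction β y)]
  have h := (Ω y).map_update_add ![infAction ξ y, infAction α y] 1 (infAction α y)
    (J y (infAction β y))
  have hu : ∀ w : TangentSpace 𝓘(ℝ, E) y, Function.update ![infAction ξ y, infAction α y] 1 w =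
      ![infAction ξ y, w] := by
    intro w
    ext i
    fin_cases i <;> simp
  rwa [hu, hu, hu] at h

theorem twoForm_J_nonneg (hΩ : IsKaehlerForm Ω) (y : X) (v : TangentSpace 𝓘(ℝ, E) y) :
    0 ≤ Ω y ![v, J y v] := by
  rcases eq_or_ne v 0 with rfl | h
  · refine le_of_eq ?_
    exact ((Ω y).map_coord_zero (m := ![0, J y 0]) 0 rfl).symm
  · exact (hΩ.pos y v h).le

/-- The derivative is `Ω(v_ξ, J v_ξ)`, the squared length of `v_ξ`. -/
theorem monotone_momentAlongRay (hΩ : IsKaehlerForm Ω) (hGc : IsHolomorphicExtension G E X)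
    (hμ : IsMomentMap Ω B μ) (x : X) (ξ : lieAlg G) : Monotone (momentAlongRay B μ x ξ) := by
  have h := fun t => hasDerivAt_moment_expI hGc hμ ξ 1 x ξ t
  simp only [mul_one] at h
  exact monotone_of_deriv_nonneg (fun t => (h t).differentiableAt) fun t => by
    change 0 ≤ deriv (fun t : ℝ => B (μ (expI (t • ξ) • x)) ξ) t
    rw [(h t).deriv]
    exact twoForm_J_nonneg hΩ _ _

end MomentDerivative

/-! ### Solving differential equations inside `G`. -/

section IntegralCurves

theorem contDiffAt_one_of_hasDerivAt {F : Type*} [NormedAddCommGroup F] [NormedSpace ℝ F]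
    {f f' : ℝ → F} {s : Set ℝ} (hs : IsOpen s) (hf : ∀ x ∈ s, HasDerivAt f (f' x) x)
    (hc : ContinuousOn f' s) {x : ℝ} (hx : x ∈ s) : ContDiffAt ℝ 1 f x :=
  contDiffAt_one_iff.2 ⟨fun y => ContinuousLinearMap.toSpanSingleton ℝ (f' y), s, hs.mem_nhds hx,
    ContinuousLinearMap.toSpanSingletonCLE.continuous.comp_continuousOn hc,
    fun y hy => (hf y hy).hasFDerivAt⟩

open scoped Matrix.Norms.L2Operator

variable {n : ℕ} {G : ClosedSubgroup (Matrix.unitaryGroup (Fin n) ℂ)}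

theorem norm_unitary_mul_le {u : Mat n} (hu : u ∈ Matrix.unitaryGroup (Fin n) ℂ) (A : Mat n) :
    ‖u * A‖ ≤ ‖A‖ :=
  (norm_mul_le _ _).trans
    (mul_le_of_le_one_left (norm_nonneg _) (norm_le_one_of_unitary (A := Mat n) hu))

theorem norm_mul_unitary_le {u : Mat n} (hu : u ∈ Matrix.unitaryGroup (Fin n) ℂ) (A : Mat n) :
    ‖A * u‖ ≤ ‖A‖ :=
  (norm_mul_le _ _).trans
    (mul_le_of_le_one_right (norm_nonneg _) (norm_le_one_of_unitary (A := Mat n) hu))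

/-- The norm here is the operator norm of matrices, not that of `B`. It keeps a small `η` small
under `Ad`. -/
theorem norm_Ad_le (u : G) (η : lieAlg G) : ‖Ad u η‖ ≤ ‖η‖ := by
  change ‖(u : Mat n) * η * star (u : Mat n)‖ ≤ ‖(η : Mat n)‖
  exact (norm_mul_unitary_le (Unitary.star_mem (u : Matrix.unitaryGroup (Fin n) ℂ).2) _).trans
    (norm_unitary_mul_le (u : Matrix.unitaryGroup (Fin n) ℂ).2 _)

/-- The matrices of the elements of `G`. -/
def matrices (G : ClosedSubgroup (Matrix.unitaryGroup (Fin n) ℂ)) : Set (Mat n) :=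
  Subtype.val '' (G : Set (Matrix.unitaryGroup (Fin n) ℂ))

theorem coe_mem_matrices (u : G) : (u : Mat n) ∈ matrices G := ⟨u.1, u.2, rfl⟩

theorem one_mem_matrices : (1 : Mat n) ∈ matrices G := coe_mem_matrices (1 : G)

theorem isClosed_matrices : IsClosed (matrices G) := by
  refine (Topology.IsClosedEmbedding.isClosedMap ?_) _ G.isClosed'
  exact (isClosed_unitary (R := Mat n)).isClosedEmbedding_subtypeVal

/-- Left multiplication by an element of `G` maps `G` to itself and does not increase the operator
norm. -/
theorem infDist_expG_mul_le (ξ : lieAlg G) (A : Mat n) :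
    Metric.infDist (NormedSpace.exp (ξ : Mat n) * A) (matrices G) ≤
      Metric.infDist A (matrices G) := by
  refine (Metric.le_infDist ⟨1, one_mem_matrices⟩).2 fun y hy => ?_
  obtain ⟨u, hu, rfl⟩ := hy
  refine (Metric.infDist_le_dist_of_mem (y := NormedSpace.exp (ξ : Mat n) * (u : Mat n))
    (coe_mem_matrices (expG ξ * ⟨u, hu⟩))).trans ?_
  rw [dist_eq_norm, dist_eq_norm, ← mul_sub]
  exact norm_unitary_mul_le (expG ξ).1.2 _

/-- A curve starting in `G` whose logarithmic derivative lies in `𝔤` stays in `G`. -/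
theorem mem_matrices_of_hasDerivAt {v : ℝ → Mat n} {b : ℝ → lieAlg G} {T : ℝ} (hT : 0 ≤ T)
    (h0 : v 0 ∈ matrices G)
    (hv : ∀ s ∈ Set.Icc 0 T, HasDerivAt v ((b s : Mat n) * v s) s) : v T ∈ matrices G := by
  have hne : (matrices G).Nonempty := ⟨1, one_mem_matrices⟩
  have hmain := image_le_of_liminf_slope_right_le_deriv_boundary
    (f := fun s => Metric.infDist (v s) (matrices G)) (a := 0) (b := T) (B := fun _ => 0)
    (B' := fun _ => 0)
    ((Metric.continuous_infDist_pt _).comp_continuousOn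
      fun s hs => (hv s hs).continuousAt.continuousWithinAt)
    (Metric.infDist_zero_of_mem h0).le continuousOn_const
    (fun s _ => hasDerivWithinAt_const _ _ _) (fun s hs r hr => ?_) (Set.right_mem_Icc.2 hT)
  · rw [isClosed_matrices.mem_iff_infDist_zero hne]
    exact le_antisymm hmain Metric.infDist_nonneg
  · refine Eventually.frequently ?_
    -- To first order `v` moves like `exp((z-s)b) v(s)`, which is no farther from `G` than `v(s)`.
    -- So the distance to `G` has upper slope at most `0`, and it starts at `0`.
    have hd : HasDerivAt (fun z => v z - NormedSpace.exp ((z - s) • (b s : Mat n)) * v s) 0 s := by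
      have h1 : HasDerivAt (fun z : ℝ => NormedSpace.exp ((z - s) • (b s : Mat n)))
          (b s : Mat n) s := by
        have h2 := hasDerivAt_exp_smul_mat (b s : Mat n) (s - s)
        have h3 := h2.comp_sub_const s s
        simpa [NormedSpace.exp_zero] using h3
      exact ((hv s ⟨hs.1, hs.2.le⟩).sub (h1.mul_const (v s))).congr_deriv (by simp)
    have hlo := (hasDerivAt_iff_isLittleO.1 hd).def (half_pos hr)
    filter_upwards [self_mem_nhdsWithin, nhdsWithin_le_nhds hlo] with z hz hlz
    have hz' : 0 < z - s := sub_pos.2 hz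
    simp only [sub_self, zero_smul, NormedSpace.exp_zero, one_mul, sub_zero, smul_zero,
      Real.norm_eq_abs, abs_of_pos hz'] at hlz
    rw [slope_def_field, div_lt_iff₀ hz']
    have h1 := Metric.infDist_le_infDist_add_dist (s := matrices G) (x := v z)
      (y := NormedSpace.exp ((z - s) • (b s : Mat n)) * v s)
    have h2 := infDist_expG_mul_le ((z - s) • b s) (v s)
    rw [dist_eq_norm] at h1
    have h3 : (((z - s) • b s : lieAlg G) : Mat n) = (z - s) • (b s : Mat n) := rfl
    rw [h3] at h2
    nlinarith [mul_pos hr hz']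

theorem exists_mem_of_hasDerivAt {v : ℝ → Mat n} {b : ℝ → lieAlg G} {ε : ℝ}
    (h0 : v 0 = 1) (hv : ∀ s ∈ Set.Ioo (-ε) ε, HasDerivAt v ((b s : Mat n) * v s) s) :
    ∃ u : ℝ → G, u 0 = 1 ∧ ∀ s ∈ Set.Ioo (-ε) ε, (u s : Mat n) = v s := by
  have h1 : v 0 ∈ matrices G := h0 ▸ one_mem_matrices
  have hmem : ∀ s ∈ Set.Ioo (-ε) ε, v s ∈ matrices G := by
    intro s hs
    rcases le_total 0 s with hs0 | hs0
    · exact mem_matrices_of_hasDerivAt hs0 h1 fun r hr =>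
        hv r ⟨by linarith [hr.1, hr.2, hs.1, hs.2], by linarith [hr.2, hs.2]⟩
    -- Negative times are reached by reversing the curve.
    · have h := mem_matrices_of_hasDerivAt (v := fun s => v (-s)) (b := fun s => -b (-s))
        (T := -s) (by linarith) (by simpa using h1) fun r hr => by
          have h2 := (hv (-r) ⟨by linarith [hr.2, hs.1], by linarith [hr.1, hs.1, hs.2]⟩).scomp r
            (hasDerivAt_neg r)
          exact h2.congr_deriv (by simp)
      simpa using h
  classical
  refine ⟨fun s => if hs : s ∈ Set.Ioo (-ε) ε ∧ s ≠ 0 then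
    ⟨(hmem s hs.1).choose, (hmem s hs.1).choose_spec.1⟩ else 1, by simp, fun s hs => ?_⟩
  by_cases hs0 : s = 0
  · subst hs0
    simp [h0]
  · simp only [dif_pos (show s ∈ Set.Ioo (-ε) ε ∧ s ≠ 0 from ⟨hs, hs0⟩)]
    exact (hmem s hs).choose_spec.2

/-- Local solutions in `G` of `u' = L(Ad(u) q) u`, on an interval that is uniform for small `q`. -/
theorem exists_curve_in_group (L : lieAlg G →ₗ[ℝ] lieAlg G) :
    ∃ r > 0, ∃ ε > 0, ∀ q : lieAlg G, ‖q‖ ≤ r → ∃ (v : ℝ → Mat n) (u : ℝ → G), u 0 = 1 ∧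
      (∀ s ∈ Set.Ioo (-ε) ε, (u s : Mat n) = v s) ∧
      (∀ s ∈ Set.Ioo (-ε) ε, ContDiffAt ℝ 1 v s) ∧
      ∀ s ∈ Set.Ioo (-ε) ε, HasDerivAt v ((L (Ad (u s) q) : Mat n) * v s) s := by
  let ι : lieAlg G →L[ℝ] Mat n := (lieAlg G).subtypeL
  let Lc : lieAlg G →L[ℝ] lieAlg G := LinearMap.toContinuousLinearMap L
  -- The parameter `q` is carried as a constant second component, so one Picard–Lindelöf interval
  -- serves all small `q`. The retraction onto `𝔤` extends the vector field from `G` to all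
  -- matrices.
  let Φ : Mat n × lieAlg G → Mat n × lieAlg G := fun p =>
    (ι (Lc (retraction G (p.1 * ι p.2 * star p.1))) * p.1, 0)
  have hstar : ContDiff ℝ 1 (fun p : Mat n × lieAlg G => star p.1) :=
    ((starL' ℝ : Mat n ≃L[ℝ] Mat n).contDiff).comp contDiff_fst
  have hΦ : ContDiff ℝ 1 Φ := by
    refine ContDiff.prodMk (ContDiff.mul ?_ contDiff_fst) contDiff_const
    refine ι.contDiff.comp (Lc.contDiff.comp ((retraction G).contDiff.comp ?_))
    exact (contDiff_fst.mul (ι.contDiff.comp contDiff_snd)).mul hstar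
  obtain ⟨r, hr, ε, hε, h⟩ :=
    (hΦ.contDiffAt (x := (1, 0))).exists_forall_mem_closedBall_exists_eq_forall_mem_Ioo_hasDerivAt 0
  refine ⟨r, hr, ε, hε, fun q hq => ?_⟩
  obtain ⟨w, hw0, hw⟩ := h (1, q) (by
    simpa [Metric.mem_closedBall, Prod.dist_eq, dist_zero_right] using hq)
  simp only [zero_sub, zero_add] at hw
  have hw1 : ∀ s ∈ Set.Ioo (-ε) ε, HasDerivAt (fun s => (w s).1) (Φ (w s)).1 s := fun s hs =>
    (ContinuousLinearMap.fst ℝ (Mat n) (lieAlg G)).hasFDerivAt.comp_hasDerivAt s (hw s hs)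
  have hw2 : ∀ s ∈ Set.Ioo (-ε) ε, (w s).2 = q := by
    have hd : ∀ s ∈ Set.Ioo (-ε) ε, HasDerivAt (fun s => (w s).2) 0 s := fun s hs =>
      (ContinuousLinearMap.snd ℝ (Mat n) (lieAlg G)).hasFDerivAt.comp_hasDerivAt s (hw s hs)
    intro s hs
    have h2 := isOpen_Ioo.is_const_of_deriv_eq_zero isPreconnected_Ioo
      (fun s hs => (hd s hs).differentiableAt.differentiableWithinAt)
      (fun s hs => (hd s hs).deriv) hs (show (0 : ℝ) ∈ Set.Ioo (-ε) ε from ⟨by linarith, hε⟩)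
    simpa [hw0] using h2
  obtain ⟨u, hu0, hu⟩ := exists_mem_of_hasDerivAt (v := fun s => (w s).1)
    (b := fun s => Lc (retraction G ((w s).1 * ι (w s).2 * star (w s).1))) (by simp [hw0]) hw1
  have hwc : ContinuousOn w (Set.Ioo (-ε) ε) := fun s hs =>
    (hw s hs).continuousAt.continuousWithinAt
  refine ⟨fun s => (w s).1, u, hu0, hu, fun s hs => contDiffAt_one_of_hasDerivAt isOpen_Ioo hw1
    (continuous_fst.comp_continuousOn (hΦ.continuous.comp_continuousOn hwc)) hs,
    fun s hs => (hw1 s hs).congr_deriv ?_⟩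
  have h3 : (w s).1 * ι (w s).2 * star (w s).1 = (Ad (u s) q : Mat n) := by
    rw [coe_Ad, hu s hs, hw2 s hs]
    rfl
  change ι (Lc (retraction G ((w s).1 * ι (w s).2 * star (w s).1))) * (w s).1 = _
  rw [h3, retraction_coe]
  rfl

end IntegralCurves

/-! ### Exchanging `∂_s` with the limit `t → ∞`. -/

section Exchange

/-- A function with a limit at infinity and bounded integrals over `[0, T]` has limit zero. -/
theorem eq_zero_of_integral_bounded {g : ℝ → ℝ} {δ C : ℝ} (hg : Continuous g)
    (hlim : Tendsto g atTop (𝓝 δ)) (hC : ∀ T, 0 ≤ T → |∫ t in (0 : ℝ)..T, g t| ≤ C) :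
    δ = 0 := by
  wlog hδ : 0 ≤ δ generalizing g δ
  · have h := this (g := fun t => -g t) (δ := -δ) hg.neg hlim.neg
      (fun T hT => by rw [intervalIntegral.integral_neg, abs_neg]; exact hC T hT)
      (by linarith)
    linarith
  by_contra hne
  have hpos : 0 < δ := lt_of_le_of_ne hδ (Ne.symm hne)
  obtain ⟨T₀, hT₀⟩ := eventually_atTop.1 (hlim.eventually (lt_mem_nhds (half_lt_self hpos)))
  set S := max T₀ 0
  have hS : 0 ≤ S := le_max_right _ _
  have hint : ∀ a b, IntervalIntegrable g MeasureTheory.volume a b :=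
    fun a b => hg.intervalIntegrable a b
  have hC0 : 0 ≤ C := (abs_nonneg _).trans (hC S hS)
  -- Beyond `S` the integrand exceeds `δ/2`, so `[S, T]` contributes at least `2C + 1`, while two
  -- integrals bounded by `C` differ by at most `2C`.
  set T := S + (2 * C + 1) / (δ / 2)
  have hST : S ≤ T := by
    have : 0 ≤ (2 * C + 1) / (δ / 2) := by positivity
    exact le_add_of_nonneg_right this
  have h1 : (T - S) * (δ / 2) ≤ ∫ t in S..T, g t := by
    have h := intervalIntegral.integral_mono_on (f := fun _ => δ / 2) hST
      intervalIntegrable_const (hint S T) fun t ht => (hT₀ t ((le_max_left _ _).trans ht.1)).le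
    simpa [mul_div_assoc] using h
  have h2 : (T - S) * (δ / 2) = 2 * C + 1 := by
    simp only [T]
    field_simp
    ring
  have h3 := intervalIntegral.integral_add_adjacent_intervals (hint 0 S) (hint S T)
  have h4 := abs_le.1 (hC S hS)
  have h5 := abs_le.1 (hC T (hS.trans hST))
  linarith [h4.1, h5.2]

/-- If `∂f/∂s = ∂Θ/∂t` with `Θ` bounded, then the limit of `f` as `t → ∞` does not depend
on `s`. -/
theorem limit_eq_of_exchange {f Θ D : ℝ → ℝ → ℝ} {ε C w₀ w₁ s₁ : ℝ}
    (hs : ∀ t, ∀ s ∈ Set.Ioo (-ε) ε, HasDerivAt (fun s => f t s) (D t s) s)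
    (ht : ∀ t, ∀ s ∈ Set.Ioo (-ε) ε, HasDerivAt (fun t => Θ t s) (D t s) t)
    (hD : ContinuousOn (fun p : ℝ × ℝ => D p.1 p.2) (Set.univ ×ˢ Set.Ioo (-ε) ε))
    (hf : ∀ s ∈ Set.Ioo (-ε) ε, Continuous fun t => f t s)
    (hC : ∀ t, 0 ≤ t → ∀ s ∈ Set.Ioo (-ε) ε, |Θ t s| ≤ C)
    (h0 : 0 < ε) (hs₁ : s₁ ∈ Set.Ioo (-ε) ε)
    (hw₀ : Tendsto (fun t => f t 0) atTop (𝓝 w₀)) (hw₁ : Tendsto (fun t => f t s₁) atTop (𝓝 w₁)) :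
    w₁ = w₀ := by
  have h0' : (0 : ℝ) ∈ Set.Ioo (-ε) ε := ⟨by linarith, h0⟩
  have hDt : ∀ s ∈ Set.Ioo (-ε) ε, Continuous fun t => D t s := fun s hs =>
    hD.comp_continuous (by fun_prop : Continuous fun t : ℝ => (t, s)) fun t => ⟨trivial, hs⟩
  -- Under the integral `∂_s f = ∂_t Θ`, which integrates to boundary values. Domination comes from
  -- continuity of `D` on a compact rectangle.
  have hderiv : ∀ T, 0 ≤ T → ∀ s ∈ Set.Ioo (-ε) ε,
      HasDerivAt (fun s => ∫ t in (0 : ℝ)..T, f t s) (Θ T s - Θ 0 s) s := by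
    intro T hT s hsI
    obtain ⟨a, ha, hsub⟩ := Metric.nhds_basis_closedBall.mem_iff.1 (isOpen_Ioo.mem_nhds hsI)
    obtain ⟨M, hM⟩ := ((isCompact_Icc (a := (0 : ℝ)) (b := T)).prod
      (isCompact_closedBall s a)).exists_bound_of_continuousOn
        (hD.mono (Set.prod_mono (Set.subset_univ _) hsub))
    have h := (intervalIntegral.hasDerivAt_integral_of_dominated_loc_of_deriv_le
      (μ := MeasureTheory.volume) (a := 0) (b := T) (F := fun s t => f t s)
      (F' := fun s t => D t s) (bound := fun _ => M) (Metric.closedBall_mem_nhds s ha)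
      ?_ ((hf s hsI).intervalIntegrable _ _) (hDt s hsI).aestronglyMeasurable ?_
      intervalIntegrable_const ?_).2
    · rwa [intervalIntegral.integral_eq_sub_of_hasDerivAt (f := fun t => Θ t s)
        (fun t _ => ht t s hsI) ((hDt s hsI).intervalIntegrable _ _)] at h
    · filter_upwards [isOpen_Ioo.mem_nhds hsI] with r hr using (hf r hr).aestronglyMeasurable
    · refine Eventually.of_forall fun t htI r hr => hM (t, r) ⟨?_, hr⟩
      rw [Set.uIoc_of_le hT] at htI
      exact ⟨htI.1.le, htI.2⟩
    · exact Eventually.of_forall fun t _ r hr => hs t r (hsub hr)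
  -- Mean value inequality in `s`; the bound is independent of `T`.
  have hbound : ∀ T, 0 ≤ T → |∫ t in (0 : ℝ)..T, (f t s₁ - f t 0)| ≤ 2 * C * |s₁| := by
    intro T hT
    have h := (convex_Ioo (-ε) ε).norm_image_sub_le_of_norm_hasDerivWithin_le (C := 2 * C)
      (fun s hs => (hderiv T hT s hs).hasDerivWithinAt) (fun s hs => ?_) h0' hs₁
    · rw [intervalIntegral.integral_sub ((hf _ hs₁).intervalIntegrable _ _)
        ((hf _ h0').intervalIntegrable _ _)]
      simpa using h
    · rw [Real.norm_eq_abs]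
      have h1 := hC T hT s hs
      have h2 := hC 0 le_rfl s hs
      linarith [abs_sub (Θ T s) (Θ 0 s)]
  exact sub_eq_zero.1
    (eq_zero_of_integral_bounded ((hf _ hs₁).sub (hf _ h0')) (hw₁.sub hw₀) hbound)

end Exchange

/-! ### Invariance of the weight along `Gᶜ`-orbits up to `G`. -/

section ComplexifiedFlow

open scoped Matrix.Norms.L2Operator

variable {n : ℕ} {G : ClosedSubgroup (Matrix.unitaryGroup (Fin n) ℂ)}

theorem inclG_mul (u v : G) : inclG (u * v) = inclG u * inclG v := by
  apply Subtype.ext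
  apply Units.ext
  rfl

theorem inclG_one : inclG (1 : G) = 1 := by
  apply Subtype.ext
  apply Units.ext
  rfl

theorem toMat_injective : Function.Injective (toMat : complexification G → Mat n) :=
  Units.val_injective.comp Subtype.val_injective

theorem expI_zero : expI (0 : lieAlg G) = 1 := by
  apply toMat_injective
  simp [toMat_expI, NormedSpace.exp_zero, toMat]

theorem expI_add_smul (ξ : lieAlg G) (s t : ℝ) :
    expI ((s + t) • ξ) = expI (s • ξ) * expI (t • ξ) := by
  apply toMat_injective
  let +nondep : NormedAlgebra ℚ (Mat n) := .restrictScalars ℚ ℂ (Mat n)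
  rw [toMat_mul, toMat_expI, toMat_expI, toMat_expI, ← NormedSpace.exp_add_of_commute]
  · congr 1
    simp only [Submodule.coe_smul, add_smul, smul_add, Submodule.coe_add]
  · simp only [Submodule.coe_smul, smul_comm Complex.I]
    exact ((Commute.refl _).smul_left s).smul_right t

theorem expI_Ad_mul (u : G) (η : lieAlg G) : expI (Ad u η) * inclG u = inclG u * expI η := by
  apply toMat_injective
  rw [toMat_mul, toMat_mul, toMat_inclG, toMat_expI, toMat_expI, coe_Ad, ← smul_mul_assoc,
    ← mul_smul_comm, exp_conj_unitary, mul_assoc, Unitary.star_mul_self_of_mem u.1.2, mul_one]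

theorem contDiff_expI (ξ : lieAlg G) : ContDiff ℝ 1 fun t : ℝ => toMat (expI (t • ξ)) := by
  refine contDiff_iff_contDiffAt.2 fun t => ?_
  have h : Continuous fun t : ℝ => toMat (expI (t • ξ)) :=
    continuous_iff_continuousAt.2 fun t => (hasDerivAt_expI ξ t).continuousAt
  exact contDiffAt_one_of_hasDerivAt isOpen_univ (fun t _ => hasDerivAt_expI ξ t)
    (continuous_const.mul h).continuousOn (Set.mem_univ t)

/-- Solutions of `c' = [ξ, a]`, `a' = -[ξ, c]` describe conjugation by `exp (i t ξ)`. -/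
theorem expI_mul_eq {ξ : lieAlg G} {a c : ℝ → lieAlg G}
    (hc : ∀ t, HasDerivAt c (ad ξ (a t)) t) (ha : ∀ t, HasDerivAt a (-ad ξ (c t)) t) (t : ℝ) :
    toMat (expI (t • ξ)) * ((a 0 : Mat n) + Complex.I • (c 0 : Mat n)) =
      ((a t : Mat n) + Complex.I • (c t : Mat n)) * toMat (expI (t • ξ)) := by
  set Z : ℝ → Mat n := fun t => (a t : Mat n) + Complex.I • (c t : Mat n)
  set A : Mat n := Complex.I • (ξ : Mat n)
  have hcoe : ∀ {γ : ℝ → lieAlg G} {γ' : lieAlg G} {t : ℝ}, HasDerivAt γ γ' t →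
      HasDerivAt (fun t => (γ t : Mat n)) (γ' : Mat n) t := fun h =>
    (lieAlg G).subtypeL.hasFDerivAt.comp_hasDerivAt _ h
  -- The system says that `Z = a + ic` solves `Z' = [iξ, Z]`, so `exp(-itξ) Z exp(itξ)` is constant.
  have hZ : ∀ t, HasDerivAt Z (A * Z t - Z t * A) t := by
    intro t
    refine ((hcoe (ha t)).add ((hcoe (hc t)).const_smul Complex.I)).congr_deriv ?_
    simp only [Submodule.coe_neg, coe_ad, A, Z, mul_add, add_mul, smul_mul_assoc, mul_smul_comm,
      smul_smul, Complex.I_mul_I, smul_sub, smul_add, neg_smul, one_smul]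
    abel
  have hexp : ∀ t : ℝ, toMat (expI (t • ξ)) = NormedSpace.exp (t • A) := by
    intro t
    rw [toMat_expI, Submodule.coe_smul, smul_comm]
  have hneg : ∀ t : ℝ, HasDerivAt (fun t : ℝ => NormedSpace.exp (-t • A))
      (-(NormedSpace.exp (-t • A) * A)) t := by
    intro t
    have h := (hasDerivAt_exp_smul_const (𝕂 := ℝ) A (-t)).scomp t (hasDerivAt_neg t)
    simpa [Function.comp_def] using h
  have hφ : ∀ t, HasDerivAt (fun t : ℝ => NormedSpace.exp (-t • A) * Z t *
      NormedSpace.exp (t • A)) 0 t := by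
    intro t
    refine (((hneg t).mul (hZ t)).mul (hasDerivAt_exp_smul_mat A t)).congr_deriv ?_
    simp only [Pi.mul_apply]
    noncomm_ring
  have hconst := is_const_of_deriv_eq_zero (fun t => (hφ t).differentiableAt)
    (fun t => (hφ t).deriv) t 0
  simp only [neg_zero, zero_smul, NormedSpace.exp_zero, one_mul, mul_one] at hconst
  have hinv : NormedSpace.exp (t • A) * NormedSpace.exp (-t • A) = 1 := by
    rw [← hexp, ← hexp, ← toMat_mul, ← expI_add_smul, add_neg_cancel, zero_smul, expI_zero]
    rfl
  change _ * Z 0 = Z t * _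
  rw [hexp, ← hconst, ← mul_assoc, ← mul_assoc, hinv, one_mul]

variable {E : Type*} [NormedAddCommGroup E] [NormedSpace ℂ E]
  {X : Type*} [TopologicalSpace X] [CompactSpace X] [ChartedSpace E X]
  [MulAction G X] [MulAction (complexification G) X]
  {Ω : TwoForm E X} {B : LinearMap.BilinForm ℝ (lieAlg G)} {μ : X → lieAlg G}

/-- For small `η`, the weight of `exp (i η) x` agrees with that of `x` up to translation by an
element of `G`. -/
theorem exists_translate_expI_small (hΩ : IsKaehlerForm Ω) (hGc : IsHolomorphicExtension G E X)
    (hμ : IsMomentMap Ω B μ) (hB : IsInvariantInner B) (ξ : lieAlg G) :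
    ∃ r > 0, ∀ η : lieAlg G, ‖η‖ ≤ r → ∀ x : X, ∃ u : G, ∀ w,
      Tendsto (momentAlongRay B μ x ξ) atTop (𝓝 w) →
      Tendsto (momentAlongRay B μ ((inclG u * expI η) • x) ξ) atTop (𝓝 w) := by
  obtain ⟨a, c, hc0, hc, ha, K, hK⟩ := exists_bounded_solution B hB.symm hB.pos (ad ξ) (hB.ad_left ξ)
  obtain ⟨r, hr, ε, hε, hcurve⟩ := exists_curve_in_group (a 0)
  obtain ⟨M, hM⟩ := exists_sqrt_moment_le hμ hB
  -- The curve exists for `‖q‖ ≤ r` and `|s| < ε`. It is used at `s = ε/2` with `η = (ε/2) q`.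
  refine ⟨r * (ε / 2), by positivity, fun η hη x => ?_⟩
  obtain ⟨v, u, hu0, huv, hvC, hv⟩ := hcurve ((ε / 2)⁻¹ • η) (by
    rw [norm_smul, norm_inv, Real.norm_eq_abs, abs_of_pos (half_pos hε), inv_mul_le_iff₀ (half_pos hε),
      mul_comm]
    exact hη)
  set q := (ε / 2)⁻¹ • η with hq
  have hqη : (ε / 2) • q = η := by rw [hq, smul_inv_smul₀ (half_pos hε).ne']
  set k : ℝ → ℝ → complexification G := fun t s => expI (t • ξ) * (inclG (u s) * expI (s • q))
  have hs₁ : ε / 2 ∈ Set.Ioo (-ε) ε := ⟨by linarith, by linarith⟩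
  have hkmat : ∀ t, ∀ s ∈ Set.Ioo (-ε) ε, toMat (k t s) =
      toMat (expI (t • ξ)) * (v s * toMat (expI (s • q))) := by
    intro t s hs
    rw [toMat_mul, toMat_mul, toMat_inclG, huv s hs]
  have hkC : ∀ t, ∀ s ∈ Set.Ioo (-ε) ε,
      ContDiffAt ℝ 1 (fun p : ℝ × ℝ => toMat (k p.1 p.2)) (t, s) := by
    intro t s hs
    have h1 : ContDiffAt ℝ 1 (fun p : ℝ × ℝ => toMat (expI (p.1 • ξ)) *
        (v p.2 * toMat (expI (p.2 • q)))) (t, s) :=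
      ((contDiff_expI ξ).contDiffAt.comp (t, s) contDiffAt_fst).mul
        (((hvC s hs).comp (t, s) contDiffAt_snd).mul
          ((contDiff_expI q).contDiffAt.comp (t, s) contDiffAt_snd))
    refine h1.congr_of_eventuallyEq ?_
    have h2 : ∀ᶠ p : ℝ × ℝ in 𝓝 (t, s), p.2 ∈ Set.Ioo (-ε) ε :=
      continuous_snd.continuousAt.eventually (isOpen_Ioo.mem_nhds hs)
    filter_upwards [h2] with p hp using hkmat _ _ hp
  -- The curve `u(s) exp(isq)` has logarithmic derivative `a(0) + i c(0)` evaluated at `Ad(u(s)) q`.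
  -- Moving `exp(itξ)` past it gives `a(t) + i c(t)`.
  have hks : ∀ t, ∀ s ∈ Set.Ioo (-ε) ε, HasDerivAt (fun s => toMat (k t s))
      (((a t (Ad (u s) q) : Mat n) + Complex.I • (c t (Ad (u s) q) : Mat n)) * toMat (k t s)) s := by
    intro t s hs
    have h1 := ((hv s hs).mul (hasDerivAt_expI q s)).const_mul (toMat (expI (t • ξ)))
    refine (h1.congr_deriv ?_).congr_of_eventuallyEq (by
      filter_upwards [isOpen_Ioo.mem_nhds hs] with s hs using hkmat t s hs)
    have h2 := expI_mul_eq (hc (Ad (u s) q)) (ha (Ad (u s) q)) t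
    rw [hc0, LinearMap.id_apply] at h2
    have h3 : v s * (q : Mat n) = (Ad (u s) q : Mat n) * v s := by
      rw [coe_Ad, ← huv s hs, mul_assoc _ (star _), Unitary.star_mul_self_of_mem (u s).1.2, mul_one]
    rw [hkmat t s hs, ← mul_assoc _ (toMat (expI (t • ξ))), ← h2, smul_mul_assoc, mul_smul_comm,
      ← mul_assoc (v s), h3]
    simp only [add_mul, mul_add, mul_assoc, smul_mul_assoc, mul_smul_comm]
  have hsmooth : ∀ t, ∀ s ∈ Set.Ioo (-ε) ε,
      ContDiffAt ℝ 1 (fun p : ℝ × ℝ => B (μ (k p.1 p.2 • x)) ξ) (t, s) := fun t s hs =>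
    contDiffAt_moment hGc hμ (hkC t s hs) x ξ
  set D : ℝ → ℝ → ℝ := fun t s => B (μ (k t s • x)) (ad ξ (a t (Ad (u s) q))) +
    Ω (k t s • x) ![infAction (c t (Ad (u s) q)) (k t s • x), J (k t s • x)
      (infAction ξ (k t s • x))] with hDdef
  have hfs : ∀ t, ∀ s ∈ Set.Ioo (-ε) ε,
      HasDerivAt (fun s => B (μ (k t s • x)) ξ) (D t s) s := by
    intro t s hs
    rw [hDdef]
    have h := hasDerivAt_moment hGc hμ (hks t s hs) x ξ
    rwa [twoForm_infAction_add hΩ hGc hμ hB] at h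
  -- On the strip `D` is the `s`-derivative of a jointly `C¹` function, so no continuity of `Ω`
  -- itself is needed.
  have hD : ContinuousOn (fun p : ℝ × ℝ => D p.1 p.2) (Set.univ ×ˢ Set.Ioo (-ε) ε) := by
    have h1 : ContDiffOn ℝ 1 (fun p : ℝ × ℝ => B (μ (k p.1 p.2 • x)) ξ)
        (Set.univ ×ˢ Set.Ioo (-ε) ε) := fun p hp => (hsmooth p.1 p.2 hp.2).contDiffWithinAt
    have h2 := (h1.continuousOn_fderiv_of_isOpen (isOpen_univ.prod isOpen_Ioo) le_rfl).clm_apply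
      (continuousOn_const (c := ((0 : ℝ), (1 : ℝ))))
    refine h2.congr fun p hp => ?_
    have h3 := ((hsmooth p.1 p.2 hp.2).differentiableAt one_ne_zero).hasFDerivAt.comp_hasDerivAt p.2
      ((hasDerivAt_const p.2 p.1).prodMk (hasDerivAt_id p.2))
    exact (hfs p.1 p.2 hp.2).unique h3
  refine ⟨u (ε / 2), fun w hw => ?_⟩
  have hmono := monotone_momentAlongRay hΩ hGc hμ ((inclG (u (ε / 2)) * expI η) • x) ξ
  have hlim : ∃ w₁, Tendsto (momentAlongRay B μ ((inclG (u (ε / 2)) * expI η) • x) ξ) atTop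
      (𝓝 w₁) := by
    refine ⟨_, tendsto_atTop_ciSup hmono ⟨M * √(B ξ ξ), ?_⟩⟩
    rintro _ ⟨t, rfl⟩
    refine (le_abs_self _).trans ((abs_apply_le_sqrt_mul_sqrt B hB.symm hB.pos _ _).trans ?_)
    gcongr
    exact hM _
  obtain ⟨w₁, hw₁⟩ := hlim
  have h0I : (0 : ℝ) ∈ Set.Ioo (-ε) ε := ⟨by linarith, hε⟩
  have hw₁w : w₁ = w := by
    refine limit_eq_of_exchange (f := fun t s => B (μ (k t s • x)) ξ)
      (Θ := fun t s => B (μ (k t s • x)) (c t (Ad (u s) q))) (D := D) (ε := ε)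
      (C := |K| * (M * √(B q q))) (s₁ := ε / 2) hfs ?_ hD ?_ ?_ hε hs₁ ?_ ?_
    · intro t s hs
      exact hasDerivAt_bilin_apply B
        (fun γ => hasDerivAt_moment_expI hGc hμ ξ (inclG (u s) * expI (s • q)) x γ t)
        (hc (Ad (u s) q) t)
    · intro s hs
      refine continuous_iff_continuousAt.2 fun t => ?_
      exact (hasDerivAt_moment_expI hGc hμ ξ (inclG (u s) * expI (s • q)) x ξ t).continuousAt
    · intro t ht s hs
      refine (hK t ht _ _).trans ?_
      rw [hB.invariant]
      gcongr
      · exact le_abs_self K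
      · exact hM _
    · refine hw.congr fun t => ?_
      simp only [k, hu0, zero_smul, inclG_one, expI_zero, mul_one]
      rfl
    · refine hw₁.congr fun t => ?_
      simp only [k, hqη, mul_smul, momentAlongRay]
  rw [← hw₁w]
  exact hw₁

/-- Every point of the `Gᶜ`-orbit of `x` has a `G`-translate of the same weight as `x`. -/
theorem exists_translate (hΩ : IsKaehlerForm Ω) (hGc : IsHolomorphicExtension G E X)
    (hμ : IsMomentMap Ω B μ) (hB : IsInvariantInner B) (ξ : lieAlg G) (x : X)
    (g : complexification G) : ∃ u : G, ∀ w,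
      Tendsto (momentAlongRay B μ x ξ) atTop (𝓝 w) →
      Tendsto (momentAlongRay B μ ((inclG u * g) • x) ξ) atTop (𝓝 w) := by
  obtain ⟨r, hr, hsmall⟩ := exists_translate_expI_small hΩ hGc hμ hB ξ
  let P : complexification G → Prop := fun g => ∃ u : G, ∀ w,
    Tendsto (momentAlongRay B μ x ξ) atTop (𝓝 w) →
    Tendsto (momentAlongRay B μ ((inclG u * g) • x) ξ) atTop (𝓝 w)
  have hincl : ∀ (v : G) g, P g → P (inclG v * g) := by
    rintro v g ⟨u, hu⟩
    refine ⟨u * v⁻¹, fun w hw => ?_⟩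
    have h : inclG (u * v⁻¹) * (inclG v * g) = inclG u * g := by
      rw [← mul_assoc, ← inclG_mul, inv_mul_cancel_right]
    rw [h]
    exact hu w hw
  -- The element `u` already found is moved past `exp(iη)`, replacing `η` by `Ad u η`.
  have hexp_small : ∀ η : lieAlg G, ‖η‖ ≤ r → ∀ g, P g → P (expI η * g) := by
    rintro η hη g ⟨u, hu⟩
    obtain ⟨u', hu'⟩ := hsmall (Ad u η) ((norm_Ad_le u η).trans hη) ((inclG u * g) • x)
    refine ⟨u' * u, fun w hw => ?_⟩
    have h : inclG (u' * u) * (expI η * g) = (inclG u' * expI (Ad u η)) * (inclG u * g) := by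
      rw [inclG_mul, mul_assoc, ← mul_assoc (inclG u), ← expI_Ad_mul]
      simp only [mul_assoc]
    rw [h, mul_smul]
    exact hu' w (hu w hw)
  -- The radius `r` does not depend on the point, so `exp(iη)` is reached in `N` small steps
  -- `exp(iη/N)`.
  have hexp : ∀ (η : lieAlg G) g, P g → P (expI η * g) := by
    intro η g hg
    obtain ⟨N, hN⟩ := exists_nat_gt (‖η‖ / r)
    have hN0 : (0 : ℝ) < N := lt_of_le_of_lt (by positivity) hN
    have hle : ‖(N : ℝ)⁻¹ • η‖ ≤ r := by
      rw [norm_smul, norm_inv, Real.norm_eq_abs, abs_of_pos hN0, inv_mul_le_iff₀ hN0]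
      exact ((div_lt_iff₀ hr).1 hN).le
    have hind : ∀ m : ℕ, P (expI ((m : ℝ) • (N : ℝ)⁻¹ • η) * g) := by
      intro m
      induction m with
      | zero => simpa [expI_zero] using hg
      | succ m ih =>
        rw [Nat.cast_succ, add_comm, expI_add_smul, one_smul, mul_assoc]
        exact hexp_small _ hle _ ih
    have h := hind N
    rwa [smul_inv_smul₀ hN0.ne'] at h
  have hall : ∀ (A : GL (Fin n) ℂ) (hA : A ∈ complexification G), P ⟨A, hA⟩ := by
    intro A hA
    refine Subgroup.closure_induction_left (p := fun A hA => P ⟨A, hA⟩) ?_ ?_ ?_ hA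
    · exact ⟨1, fun w hw => by
        rw [inclG_one, one_mul]
        exact (one_smul (complexification G) x).symm ▸ hw⟩
    · rintro _ ⟨η, u, rfl⟩ y hy hPy
      have h := hexp η _ (hincl u _ hPy)
      rw [← mul_assoc] at h
      exact h
    -- Inverse of a generator: `(exp(iη)u)⁻¹ = u⁻¹ exp(-iη)`.
    · rintro _ ⟨η, u, rfl⟩ y hy hPy
      have h := hincl u⁻¹ _ (hexp (-η) _ hPy)
      rw [← mul_assoc] at h
      have h2 : inclG u⁻¹ * expI (-η) = (expI η * inclG u)⁻¹ := by
        rw [eq_inv_iff_mul_eq_one, mul_assoc, ← mul_assoc (expI (-η))]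
        have h3 : expI (-η) * expI η = 1 := by
          have h4 : (-1 : ℝ) • η = -η := Subtype.ext (by simp)
          rw [← h4]
          simpa [expI_zero] using (expI_add_smul η (-1) 1).symm
        rw [h3, one_mul, ← inclG_mul, inv_mul_cancel, inclG_one]
      rw [h2] at h
      exact h
  exact hall g.1 g.2

end ComplexifiedFlow

end MomentWeight

/-! ### The moment-weight inequality. -/

theorem theorem6p5 {n : ℕ} (G : ClosedSubgroup (Matrix.unitaryGroup (Fin n) ℂ))
    {E : Type*} [NormedAddCommGroup E] [NormedSpace ℂ E] [FiniteDimensional ℂ E]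
    {X : Type*} [TopologicalSpace X] [T2Space X] [CompactSpace X]
    [ChartedSpace E X] [IsManifold 𝓘(ℂ, E) ω X]
    (Ω : MomentWeight.TwoForm E X) (hΩ : MomentWeight.IsKaehlerForm Ω)
    [MulAction G X] (hG : MomentWeight.IsKaehlerAction G Ω)
    [MulAction (MomentWeight.complexification G) X]
    (hGc : MomentWeight.IsHolomorphicExtension G E X)
    (B : LinearMap.BilinForm ℝ (MomentWeight.lieAlg G)) (hB : MomentWeight.IsInvariantInner B)
    (μ : X → MomentWeight.lieAlg G) (hμ : MomentWeight.IsMomentMap Ω B μ)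
    (x : X) (ξ : MomentWeight.lieAlg G) (hξ : ξ ≠ 0) :
    Tendsto (MomentWeight.momentAlongRay B μ x ξ) atTop (𝓝 (MomentWeight.muWeight B μ x ξ)) ∧
    ∀ g : MomentWeight.complexification G,
      -MomentWeight.muWeight B μ x ξ / MomentWeight.innerNorm B ξ ≤
        MomentWeight.innerNorm B (μ (g • x)) := by
  have hlim : Tendsto (MomentWeight.momentAlongRay B μ x ξ) atTop
      (𝓝 (MomentWeight.muWeight B μ x ξ)) := by
    obtain ⟨M, hM⟩ := MomentWeight.exists_sqrt_moment_le hμ hB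
    refine tendsto_nhds_limUnder ⟨_, tendsto_atTop_ciSup
      (MomentWeight.monotone_momentAlongRay hΩ hGc hμ x ξ) ⟨M * √(B ξ ξ), ?_⟩⟩
    rintro _ ⟨t, rfl⟩
    refine (le_abs_self _).trans
      ((MomentWeight.abs_apply_le_sqrt_mul_sqrt B hB.symm hB.pos _ _).trans ?_)
    gcongr
    exact hM _
  refine ⟨hlim, fun g => ?_⟩
  obtain ⟨u, hu⟩ := MomentWeight.exists_translate hΩ hGc hμ hB ξ x g
  -- The ray from `u g x` increases to the weight of `x`, so its value at `t = 0` is a lower bound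
  -- for that weight.
  have hge := (MomentWeight.monotone_momentAlongRay hΩ hGc hμ
    ((MomentWeight.inclG u * g) • x) ξ).ge_of_tendsto (hu _ hlim) 0
  have h0 : MomentWeight.momentAlongRay B μ ((MomentWeight.inclG u * g) • x) ξ 0 =
      B (MomentWeight.Ad u (μ (g • x))) ξ := by
    rw [MomentWeight.momentAlongRay, zero_smul, MomentWeight.expI_zero, one_smul, mul_smul,
      hGc.extends_action, hμ.equivariant]
  rw [h0] at hge
  have hcs := MomentWeight.abs_apply_le_sqrt_mul_sqrt B hB.symm hB.pos
    (MomentWeight.Ad u (μ (g • x))) ξ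
  rw [hB.invariant] at hcs
  rw [MomentWeight.innerNorm, MomentWeight.innerNorm, div_le_iff₀ (Real.sqrt_pos.2 (hB.pos ξ hξ))]
  linarith [(abs_le.1 hcs).1]
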